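/- Let $B^4\subset\mathbb R^4$ be the open unit ball with the flat metric, $\iota:\partial B^4\to\overline{B}^4$ the inclusion, and write $\mathfrak{so}(3)$-valued forms in components with respect to the basis $i,j,k$ of $\mathfrak{so}(3)\cong\operatorname{Im}\mathbb H$, as $A=A_1i+A_2j+A_3k$. For a 2-form $\omega$ put $\omega^-=(\omega-*\omega)/2$, and let $(\omega,\eta)=\sum_{a<b}\omega_{ab}\eta_{ab}$ be the pointwise inner product of 2-forms. For $p\in B^4$ let $h_p=h_{p,1}i+h_{p,2}j+h_{p,3}k$ be the $1$-form on $\overline{B}^4$ that is harmonic in $B^4$ (that is, $\Delta h_p=0$), continuous on $\overline{B}^4$, and equal in all its components to $$h_p(x)=\operatorname{Im}\frac{(\bar x-\bar p)\,dx}{|x-p|^4}\qquad(x\in\partial B^4),$$ where $\mathbb R^4\cong\mathbb H$ by $x=x_1+x_2i+x_3j+x_4k$. For a boundary connection $A_0\in C^\infty(T^*\partial B^4\otimes\mathfrak{so}(3))$ let $\underline A_0\in C^\infty(T^*\overline{B}^4\otimes\mathfrak{so}(3))$ be any solution of the linear Dirichlet problem $$d^*dA=0\ \text{ in } B^4,\qquad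 \iota^*A\sim A_0\ \text{ on }\partial B^4,$$ where $\sim$ means equality up to $d\varphi$ for some $\varphi\in C^\infty(\partial B^4,\mathfrak{so}(3))$. Define the $3\times3$ matrix $M(A_0,p)=(m_{ij}(A_0,p))$ by $$m_{ij}(A_0,p)=\int_{B^4}\bigl((d\underline A_{0,j})^-,(dh_{p,i})^-\bigr)\,dx\qquad(1\le i,j\le 3).$$ **Proposition.** For every $A_0\in C^\infty(T^*\partial B^4\otimes\mathfrak{so}(3))$ and every $p_0\in B^4$ there is an arbitrarily small perturbation $\tilde A_0\in C^\infty(T^*\partial B^4\otimes\mathfrak{so}(3))$ of $A_0$ (for all $k\in\mathbb N$ and $\varepsilon>0$ there is such an $\tilde A_0$ with $\|\tilde A_0-A_0\|_{C^k(\partial B^4)}<\varepsilon$) such that $M(\tilde A_0,p_0)$ is well defined (the Dirichlet problems for $\underline{\tilde A}_0$ and $h_{p_0}$ are solvable, and all their solutions give the same matrix) and the eigenvalues of $M(\tilde A_0,p_0)^tM(\tilde A_0,p_0)$, listed with multiplicity, satisfy $$\mu_1>\mu_2>\mu_3>0.$$ -/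

import Mathlib

open scoped ContDiff Manifold

noncomputable section

namespace YangMillsBall

/-- Euclidean space `ℝ⁴`; its standard coordinates are `x¹ = x 0, …, x⁴ = x 3`. -/
abbrev R4 : Type := EuclideanSpace ℝ (Fin 4)

/-- The open unit ball `B⁴`. -/
def ball4 : Set R4 := Metric.ball 0 1

/-- The closed unit ball. -/
def closedBall4 : Set R4 := Metric.closedBall 0 1

/-- The unit sphere `S³ = ∂B⁴`. -/
abbrev S3 : Type := Metric.sphere (0 : R4) 1

/-- The dimension count that puts Mathlib's smooth manifold structure on `S³`. -/
instance factFinrankR4 : Fact (Module.finrank ℝ R4 = 3 + 1) := ⟨by simp⟩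

/-- The Lie algebra `𝔰𝔬(3) ≅ 𝔰𝔲(2) ≅ Im ℍ`, in coordinates with respect to its basis `i, j, k`. -/
abbrev LieAlg : Type := EuclideanSpace ℝ (Fin 3)

/-- A Lie algebra valued 1-form on (a subset of) `ℝ⁴`. -/
abbrev OneForm : Type := R4 → (R4 →L[ℝ] LieAlg)

/-- The standard basis of `ℝ⁴`. -/
def stdVec (a : Fin 4) : R4 := EuclideanSpace.single a 1

/-- The exterior derivative `dA` of a Lie algebra valued 1-form. -/
def extD (A : OneForm) : R4 → R4 [⋀^Fin 2]→L[ℝ] LieAlg :=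
  extDeriv (fun y => ContinuousAlternatingMap.ofSubsingleton ℝ R4 LieAlg (0 : Fin 1) (A y))

/-- The coefficients of the real 2-form `dA_l`, where `A = A_0 i + A_1 j + A_2 k`:
`dA_l = ∑_{a < b} (extDCoeff A l x a b) dxᵃ ∧ dxᵇ` at `x`. -/
def extDCoeff (A : OneForm) (l : Fin 3) (x : R4) (a b : Fin 4) : ℝ :=
  (extD A x ![stdVec a, stdVec b]) l

/-- The Levi-Civita symbol in four indices: the determinant of the matrix with rows
`e_a, e_b, e_c, e_d`. -/
def leviCivita (a b c d : Fin 4) : ℝ :=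
  (Matrix.of fun r s : Fin 4 => if ![a, b, c, d] r = s then (1 : ℝ) else 0).det

/-- The Hodge star on (coefficients of) 2-forms for the flat metric of `ℝ⁴`. -/
def hodgeStar (w : Fin 4 → Fin 4 → ℝ) (a b : Fin 4) : ℝ :=
  (1 / 2) * ∑ c, ∑ d, leviCivita a b c d * w c d

/-- The anti-self-dual component `w⁻ = (w - *w) / 2`. -/
def asd (w : Fin 4 → Fin 4 → ℝ) (a b : Fin 4) : ℝ := (w a b - hodgeStar w a b) / 2

/-- The pointwise inner product of 2-forms, `(w, z) = ∑_{a < b} w_{ab} z_{ab}`. -/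
def inner2 (w z : Fin 4 → Fin 4 → ℝ) : ℝ := (1 / 2) * ∑ a, ∑ b, w a b * z a b

/-- A smooth boundary connection, that is, a smooth `𝔰𝔬(3)`-valued 1-form on `S³`. The tangent
space `T_x S³` is the orthogonal complement of `x`, and a linear map on it is the same thing as a
linear map on `ℝ⁴` that kills `x`. -/
structure BoundaryConnection where
  /-- the 1-form at each point, extended by zero to the normal direction -/
  form : S3 → (R4 →L[ℝ] LieAlg)
  normal_eq_zero : ∀ x : S3, form x (x : R4) = 0
  smooth : ContMDiff (𝓡 3) 𝓘(ℝ, R4 →L[ℝ] LieAlg) ∞ form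

/-- The extension of a function on `S³` to `ℝ⁴ ∖ {0}` that is constant on rays (with the
irrelevant value `0` at the origin). -/
def radialExt {V : Type*} [Zero V] (f : S3 → V) (x : R4) : V :=
  if hx : x ≠ 0 then f ⟨‖x‖⁻¹ • x, by simp [norm_smul, norm_ne_zero_iff.mpr hx]⟩ else 0

/-- `A` and `B` are `ε`-close in `C^k(S³)`: at each point of `S³`, all derivatives of order at most
`k` of the difference (extended constantly along rays) have norm less than `ε`. -/
def BoundaryConnection.CkClose (k : ℕ) (ε : ℝ) (A B : BoundaryConnection) : Prop :=
  ∀ m : ℕ, m ≤ k → ∀ x : S3,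
    ‖iteratedFDeriv ℝ m (radialExt fun y => A.form y - B.form y) (x : R4)‖ < ε

/-- `A` is smooth up to the boundary and solves the linear Dirichlet problem `d*dA = 0` in `B⁴`,
`ι*A ∼ A₀` on `∂B⁴`. Here `(d*w)_b = -∑_a ∂_a w_{ab}`, and `∼` is gauge equivalence for the
linear problem: the two sides differ by `dφ` for a smooth Lie algebra valued function `φ`
(smooth functions on `S³` being the restrictions of smooth functions on `ℝ⁴`). -/
def IsLinearSolution (A₀ : BoundaryConnection) (A : OneForm) : Prop :=
  ContDiffOn ℝ ∞ A closedBall4 ∧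
  (∀ x ∈ ball4, ∀ l : Fin 3, ∀ b : Fin 4,
    ∑ a : Fin 4, fderiv ℝ (fun y => extDCoeff A l y a b) x (stdVec a) = 0) ∧
  ∃ φ : R4 → LieAlg, ContDiff ℝ ∞ φ ∧
    ∀ x : S3, ∀ v : R4, inner ℝ (x : R4) v = 0 →
      A (x : R4) v = A₀.form x v + fderiv ℝ φ (x : R4) v

/-- `ℝ⁴ ≅ ℍ`, `x ↦ x¹ + x² i + x³ j + x⁴ k`. -/
def toQuat (x : R4) : Quaternion ℝ := ⟨x 0, x 1, x 2, x 3⟩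

/-- The imaginary part of a quaternion, in coordinates with respect to `i, j, k`. -/
def imPart (q : Quaternion ℝ) : LieAlg := !₂[q.imI, q.imJ, q.imK]

/-- `h` is the 1-form `h_p`: it is harmonic in `B⁴`, continuous up to the boundary, and equal (in
all its components, not only the tangential ones) to `Im ((x̄ - p̄) dx) / |x - p|⁴` on `∂B⁴`. -/
def IsHarmonicForm (p : R4) (h : OneForm) : Prop :=
  InnerProductSpace.HarmonicOnNhd h ball4 ∧
  ContinuousOn h closedBall4 ∧
  ∀ x : S3, ∀ v : R4,
    h (x : R4) v = (‖(x : R4) - p‖ ^ 4)⁻¹ • imPart (star (toQuat ((x : R4) - p)) * toQuat v)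

/-- The number `∫_{B⁴} ((dA_j)⁻, (dh_i)⁻) dx`. -/
def pairing (A h : OneForm) (i j : Fin 3) : ℝ :=
  ∫ x in ball4, inner2 (asd (extDCoeff A j x)) (asd (extDCoeff h i x))

/-- `M` is the matrix `M(A₀, p)`, with entries `m_{ij} = ∫_{B⁴} ((dA̲_{0,j})⁻, (dh_{p,i})⁻) dx`,
where `A̲₀` is a solution of the linear Dirichlet problem with boundary value `A₀`. Since `M(A₀, p)`
has to be well defined, the Dirichlet problems for `A̲₀` and `h_p` must be solvable, and all of
their solutions must give the matrix `M`. -/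
def IsMatrixM (A₀ : BoundaryConnection) (p : R4) (M : Matrix (Fin 3) (Fin 3) ℝ) : Prop :=
  (∃ A, IsLinearSolution A₀ A) ∧ (∃ h, IsHarmonicForm p h) ∧
  ∀ A h, IsLinearSolution A₀ A → IsHarmonicForm p h → M = Matrix.of (pairing A h)

end YangMillsBall

end

open scoped ContDiff Manifold

noncomputable section

namespace YangMillsBall

open MeasureTheory Filter Topology Set

/-! The singular values of a 3×3 matrix are simple and nonzero off the zero set of a polynomial in
its entries. It therefore suffices to move `M` along a line that leaves this zero set, in a
direction for which the Dirichlet problem is explicitly solvable.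

The direction is the form `polyForm diagPoly`, with components B_l = (l+1)(Im x̄ dx)_l for l = 0, 1,
2. Its differential is constant and anti-self-dual, dB_l = 2(l+1)ω_l with ω_l the basis `asdInt`, so
pairing it with dh_p involves only the integral of dh_p over the ball. A Kelvin transform writes h_p
explicitly as a form harmonic beyond the sphere, and the mean value property reduces that integral
to the value at the origin, which does not depend on p. Hence adding tB to the boundary data adds
t·N to `M`, where N = diag(κ, 2κ, 3κ) and κ = 8 vol(B⁴) (`pairing_diagPoly`). For S = sM + N, the
product of det S and the discriminant of the characteristic polynomial of SᵀS is a polynomial in s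
that is nonzero at s = 0. It is therefore nonzero for arbitrarily large s = 1/t
(`exists_small_perturbation`).

Solvability needs no elliptic theory. The given A₀ is first replaced by the tangential part of a
polynomial form, C^k-close to it (`exists_polynomial_ckClose`, convolution with a polynomial
kernel). Polynomial data have a polynomial solution of d*dA = 0 (`exists_coclosed_poly`), found by
finite-dimensional linear algebra and inversion of a shifted Euler operator.

`M` is well defined because h_p is unique by the maximum principle, and because two solutions for
the same A₀ have the same differential almost everywhere by an energy identity
(`IsLinearSolution.ae_extDCoeff_eq`). The energy identity and the mean value property both rest on
the divergence theorem for fields tangent to the sphere, `integral_div_eq_zero`. -/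

/-! ### The unit ball and the divergence theorem for tangential fields -/

theorem interior_closedBall4 : interior closedBall4 = ball4 := by
  rw [ball4, closedBall4, interior_closedBall _ one_ne_zero]

theorem isOpen_ball4 : IsOpen ball4 := Metric.isOpen_ball

theorem isCompact_closedBall4 : IsCompact closedBall4 := isCompact_closedBall _ _

theorem ball4_subset_closedBall4 : ball4 ⊆ closedBall4 := Metric.ball_subset_closedBall

theorem mem_ball4 {x : R4} : x ∈ ball4 ↔ ‖x‖ < 1 := by simp [ball4]

theorem mem_closedBall4 {x : R4} : x ∈ closedBall4 ↔ ‖x‖ ≤ 1 := by simp [closedBall4]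

theorem convex_closedBall4 : Convex ℝ closedBall4 := convex_closedBall _ _

theorem uniqueDiffOn_closedBall4 : UniqueDiffOn ℝ closedBall4 := by
  apply uniqueDiffOn_convex convex_closedBall4
  rw [interior_closedBall4]
  exact ⟨0, by simp [ball4]⟩

theorem closedBall4_mem_nhds {x : R4} (hx : x ∈ ball4) : closedBall4 ∈ 𝓝 x :=
  mem_of_superset (isOpen_ball4.mem_nhds hx) ball4_subset_closedBall4

theorem volume_ball4_lt_top : volume ball4 < ⊤ := measure_ball_lt_top

theorem volume_ball4_pos : 0 < volume.real ball4 := by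
  rw [Measure.real, ENNReal.toReal_pos_iff]
  exact ⟨Metric.measure_ball_pos _ _ one_pos, volume_ball4_lt_top⟩

theorem sum_smul_stdVec (x : R4) : ∑ a, x a • stdVec a = x := by
  ext b
  fin_cases b <;> simp [stdVec, Fin.sum_univ_four]

@[simp] theorem stdVec_apply (a b : Fin 4) : stdVec a b = if b = a then 1 else 0 := by
  simp [stdVec]

theorem norm_sq_eq_sum (x : R4) : ‖x‖ ^ 2 = ∑ a, x a ^ 2 := by
  simp [EuclideanSpace.norm_sq_eq]

theorem inner_eq_sum (x y : R4) : inner ℝ x y = ∑ a, x a * y a := by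
  simp [PiLp.inner_apply, mul_comm]

theorem inner_stdVec (x : R4) (a : Fin 4) : inner ℝ x (stdVec a) = x a := by
  simp [inner_eq_sum]

/-- A function that is `C¹` up to the boundary has bounded derivative and is Lipschitz. -/
theorem exists_bound_of_contDiffOn {f : R4 → ℝ} (hf : ContDiffOn ℝ 1 f closedBall4) :
    ∃ C : ℝ, 0 ≤ C ∧ (∀ x ∈ ball4, ‖fderiv ℝ f x‖ ≤ C) ∧
      ∀ x ∈ closedBall4, ∀ y ∈ closedBall4, |f x - f y| ≤ C * ‖x - y‖ := by
  have hc := hf.continuousOn_fderivWithin uniqueDiffOn_closedBall4 le_rfl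
  obtain ⟨C, hC⟩ := isCompact_closedBall4.exists_bound_of_continuousOn hc
  refine ⟨max C 0, le_max_right _ _, fun x hx => ?_, fun x hx y hy => ?_⟩
  · rw [← fderivWithin_of_mem_nhds (closedBall4_mem_nhds hx)]
    exact (hC x (ball4_subset_closedBall4 hx)).trans (le_max_left _ _)
  · exact convex_closedBall4.norm_image_sub_le_of_norm_fderivWithin_le
      (hf.differentiableOn one_ne_zero)
      (fun z hz => (hC z hz).trans (le_max_left _ _)) hy hx

theorem deriv_smoothTransition_of_nonpos_or {t : ℝ} (ht : t < 0 ∨ 1 < t) :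
    deriv Real.smoothTransition t = 0 := by
  rcases ht with ht | ht
  · have : Real.smoothTransition =ᶠ[𝓝 t] fun _ => 0 :=
      mem_of_superset (Iio_mem_nhds ht) fun s hs => Real.smoothTransition.zero_of_nonpos (le_of_lt hs)
    rw [this.deriv_eq, deriv_const]
  · have : Real.smoothTransition =ᶠ[𝓝 t] fun _ => 1 :=
      mem_of_superset (Ioi_mem_nhds ht) fun s hs => Real.smoothTransition.one_of_one_le (le_of_lt hs)
    rw [this.deriv_eq, deriv_const]

/-- The derivative of the smooth transition function is bounded. -/
theorem exists_bound_deriv_smoothTransition :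
    ∃ C : ℝ, 0 ≤ C ∧ ∀ t, |deriv Real.smoothTransition t| ≤ C := by
  have hc : Continuous (deriv Real.smoothTransition) :=
    (Real.smoothTransition.contDiff (n := 1)).continuous_deriv le_rfl
  obtain ⟨C, hC⟩ := (isCompact_Icc (a := (0 : ℝ)) (b := 1)).exists_bound_of_continuousOn
    hc.continuousOn
  refine ⟨max C 0, le_max_right _ _, fun t => ?_⟩
  by_cases ht : t ∈ Icc (0 : ℝ) 1
  · exact (hC t ht).trans (le_max_left _ _)
  · rw [mem_Icc, not_and_or, not_le, not_le] at ht
    simp [deriv_smoothTransition_of_nonpos_or ht]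

/-- A radial cutoff function which vanishes near the unit sphere. -/
def radialCutoff (n : ℕ) (x : R4) : ℝ := Real.smoothTransition (n * (1 - ‖x‖ ^ 2) - 1)

theorem contDiff_radialCutoff (n : ℕ) : ContDiff ℝ 1 (radialCutoff n) := by
  unfold radialCutoff
  exact Real.smoothTransition.contDiff.comp
    ((contDiff_const.mul (contDiff_const.sub (contDiff_norm_sq ℝ))).sub contDiff_const)

theorem fderiv_radialCutoff (n : ℕ) (x v : R4) : fderiv ℝ (radialCutoff n) x v =
    deriv Real.smoothTransition (n * (1 - ‖x‖ ^ 2) - 1) * (n * (-2 * inner ℝ x v)) := by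
  have h1 : HasFDerivAt (fun y : R4 => (n : ℝ) * (1 - ‖y‖ ^ 2) - 1)
      ((n : ℝ) • (-((2 : ℕ) • innerSL ℝ x) : R4 →L[ℝ] ℝ)) x := by
    have := (((hasStrictFDerivAt_norm_sq x).hasFDerivAt.const_sub 1).const_mul (n : ℝ)).sub_const 1
    exact this
  have h2 : DifferentiableAt ℝ Real.smoothTransition (n * (1 - ‖x‖ ^ 2) - 1) :=
    (Real.smoothTransition.contDiff (n := 1)).contDiffAt.differentiableAt one_ne_zero
  have h3 := h2.hasDerivAt.comp_hasFDerivAt x h1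
  have : radialCutoff n = Real.smoothTransition ∘ fun y : R4 => (n : ℝ) * (1 - ‖y‖ ^ 2) - 1 := rfl
  rw [this, h3.fderiv]
  simp

/-- Integration by parts against the constant function 1. -/
theorem integral_fderiv_eq_zero {G : R4 → ℝ} (hG : ContDiff ℝ 1 G) (hs : HasCompactSupport G)
    (v : R4) : ∫ x, fderiv ℝ G x v = 0 := by
  have hc : Continuous fun x => fderiv ℝ G x v := (hG.continuous_fderiv one_ne_zero).clm_apply continuous_const
  have hi : Integrable fun x => fderiv ℝ G x v := by
    apply hc.integrable_of_hasCompactSupport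
    exact (hs.fderiv ℝ).mono' fun x hx => by
      apply subset_tsupport
      rw [Function.mem_support] at hx ⊢
      intro h
      simp [h] at hx
  have := integral_mul_fderiv_eq_neg_fderiv_mul_of_integrable (μ := volume) (𝕜 := ℝ)
    (f := fun _ : R4 => (1 : ℝ)) (g := G) (v := v) (by simp) (by simpa using hi)
    (by simpa using hG.continuous.integrable_of_hasCompactSupport hs)
    (fun x _ => differentiableAt_const _)
    (fun x _ => hG.differentiable one_ne_zero x)
  simpa using this

/-- The cutoff vanishes on a neighbourhood of the complement of the open ball, so the values of `f`
outside the closed ball, about which nothing is known, do not matter. -/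
theorem contDiff_radialCutoff_mul (n : ℕ) {f : R4 → ℝ}
    (hf : ContDiffOn ℝ 1 f closedBall4) : ContDiff ℝ 1 (fun x => radialCutoff n x * f x) := by
  rw [contDiff_iff_contDiffAt]
  intro x
  by_cases hx : x ∈ ball4
  · exact (contDiff_radialCutoff n).contDiffAt.mul (hf.contDiffAt (closedBall4_mem_nhds hx))
  · have : (fun x => radialCutoff n x * f x) =ᶠ[𝓝 x] fun _ => 0 := by
      have ho : IsOpen {y : R4 | (n : ℝ) * (1 - ‖y‖ ^ 2) - 1 < 0} :=
        isOpen_lt (by fun_prop) continuous_const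
      filter_upwards [ho.mem_nhds (show (n : ℝ) * (1 - ‖x‖ ^ 2) - 1 < 0 by
        rw [mem_ball4, not_lt] at hx
        have : (1 - ‖x‖ ^ 2) ≤ 0 := by nlinarith
        have := mul_nonpos_of_nonneg_of_nonpos (Nat.cast_nonneg (α := ℝ) n) this
        linarith)] with y hy
      rw [radialCutoff, Real.smoothTransition.zero_of_nonpos (le_of_lt hy), zero_mul]
    exact contDiffAt_const.congr_of_eventuallyEq this

theorem radialCutoff_eq_zero (n : ℕ) {x : R4} (hx : x ∉ ball4) : radialCutoff n x = 0 := by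
  apply Real.smoothTransition.zero_of_nonpos
  rw [mem_ball4, not_lt] at hx
  have : (1 - ‖x‖ ^ 2) ≤ 0 := by nlinarith
  have := mul_nonpos_of_nonneg_of_nonpos (Nat.cast_nonneg (α := ℝ) n) this
  linarith

/-- The divergence of a vector field that is tangent to the unit sphere has integral zero. -/
theorem integral_div_eq_zero {F : Fin 4 → R4 → ℝ} (hF : ∀ b, ContDiffOn ℝ 1 (F b) closedBall4)
    (hn : ∀ x : R4, ‖x‖ = 1 → ∑ b, x b * F b x = 0) :
    ∫ x in ball4, ∑ b, fderiv ℝ (F b) x (stdVec b) = 0 := by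
  obtain ⟨K, hK0, hK⟩ := exists_bound_deriv_smoothTransition
  have hN : ContDiffOn ℝ 1 (fun x : R4 => ∑ b, x b * F b x) closedBall4 := by
    apply ContDiffOn.sum
    intro b _
    exact ContDiffOn.mul (by fun_prop) (hF b)
  obtain ⟨L, hL0, -, hL⟩ := exists_bound_of_contDiffOn hN
  choose C hC0 hC _ using fun b => exists_bound_of_contDiffOn (hF b)
  have hfd : ∀ b, ContinuousOn (fun x => fderiv ℝ (F b) x (stdVec b)) ball4 := by
    intro b
    exact (((hF b).mono ball4_subset_closedBall4).continuousOn_fderiv_of_isOpen isOpen_ball4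
      le_rfl).clm_apply continuousOn_const
  -- This is the divergence of the cutoff times F. The second term concentrates near the sphere and
  -- plays the role of the boundary flux.
  set I : ℕ → R4 → ℝ := fun n x => radialCutoff n x * ∑ b, fderiv ℝ (F b) x (stdVec b) +
    deriv Real.smoothTransition (n * (1 - ‖x‖ ^ 2) - 1) * (n * (-2 * ∑ b, x b * F b x)) with hI
  have hzero : ∀ n : ℕ, ∫ x in ball4, I n x = 0 := by
    intro n
    have hs : ∀ b, HasCompactSupport (fun x => radialCutoff n x * F b x) := fun b =>
      HasCompactSupport.intro isCompact_closedBall4 fun x hx => by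
        rw [radialCutoff_eq_zero n (fun h => hx (ball4_subset_closedBall4 h)), zero_mul]
    have hcd := fun b => contDiff_radialCutoff_mul n (hF b)
    have h0 : ∑ b, ∫ x, fderiv ℝ (fun x => radialCutoff n x * F b x) x (stdVec b) = 0 :=
      Finset.sum_eq_zero fun b _ => integral_fderiv_eq_zero (hcd b) (hs b) _
    have hint : ∀ b, Integrable fun x =>
        fderiv ℝ (fun x => radialCutoff n x * F b x) x (stdVec b) := by
      intro b
      apply (((hcd b).continuous_fderiv one_ne_zero).clm_apply
        continuous_const).integrable_of_hasCompactSupport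
      exact ((hs b).fderiv ℝ).mono' fun x hx => by
        apply subset_tsupport
        rw [Function.mem_support] at hx ⊢
        intro h
        simp [h] at hx
    rw [← integral_finsetSum _ fun b _ => hint b] at h0
    refine (Eq.trans ?_ (setIntegral_eq_integral_of_forall_compl_eq_zero (s := ball4) ?_)).trans h0
    · apply setIntegral_congr_fun isOpen_ball4.measurableSet
      intro x hx
      have : ∀ b, fderiv ℝ (fun x => radialCutoff n x * F b x) x (stdVec b) =
          radialCutoff n x * fderiv ℝ (F b) x (stdVec b) +
          F b x * fderiv ℝ (radialCutoff n) x (stdVec b) := by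
        intro b
        rw [fderiv_fun_mul ((contDiff_radialCutoff n).differentiable one_ne_zero x)
          (((hF b).contDiffAt (closedBall4_mem_nhds hx)).differentiableAt one_ne_zero)]
        simp
      simp only [this, fderiv_radialCutoff, inner_stdVec, hI, Finset.sum_add_distrib,
        Finset.mul_sum]
      congr 1
      apply Finset.sum_congr rfl
      intro b _
      ring
    · intro x hx
      apply Finset.sum_eq_zero
      intro b _
      by_cases hx1 : x ∈ closedBall4
      · have hx1 : ‖x‖ = 1 := by
          rw [mem_ball4] at hx
          rw [mem_closedBall4] at hx1
          linarith
        have : (fun x => radialCutoff n x * F b x) =ᶠ[𝓝 x] fun _ => 0 := by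
          have ho : IsOpen {y : R4 | (n : ℝ) * (1 - ‖y‖ ^ 2) - 1 < 0} :=
            isOpen_lt (by fun_prop) continuous_const
          filter_upwards [ho.mem_nhds (show (n : ℝ) * (1 - ‖x‖ ^ 2) - 1 < 0 by simp [hx1])]
            with y hy
          rw [radialCutoff, Real.smoothTransition.zero_of_nonpos (le_of_lt hy), zero_mul]
        rw [this.fderiv_eq]
        simp
      · have : (fun x => radialCutoff n x * F b x) =ᶠ[𝓝 x] fun _ => 0 := by
          filter_upwards [isCompact_closedBall4.isClosed.isOpen_compl.mem_nhds hx1] with y hy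
          rw [radialCutoff_eq_zero n (fun h => hy (ball4_subset_closedBall4 h)), zero_mul]
        rw [this.fderiv_eq]
        simp
  have hlim : Tendsto (fun n => ∫ x in ball4, I n x) atTop
      (𝓝 (∫ x in ball4, ∑ b, fderiv ℝ (F b) x (stdVec b))) := by
    apply tendsto_integral_of_dominated_convergence (fun _ => ∑ b, C b + K * (4 * L))
    · intro n
      apply ContinuousOn.aestronglyMeasurable _ isOpen_ball4.measurableSet
      apply ContinuousOn.add
      · exact (contDiff_radialCutoff n).continuous.continuousOn.mul
          (continuousOn_finsetSum _ fun b _ => hfd b)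
      · apply ContinuousOn.mul
        · exact (((Real.smoothTransition.contDiff (n := 1)).continuous_deriv le_rfl).comp
            (by fun_prop)).continuousOn
        · exact continuousOn_const.mul (continuousOn_const.mul
            (hN.continuousOn.mono ball4_subset_closedBall4))
    · exact integrableOn_const volume_ball4_lt_top.ne
    · intro n
      rw [ae_restrict_iff' isOpen_ball4.measurableSet]
      refine Eventually.of_forall fun x hx => ?_
      refine (norm_add_le _ _).trans (add_le_add ?_ ?_)
      · rw [norm_mul]
        have h1 : ‖radialCutoff n x‖ ≤ 1 := by
          rw [Real.norm_eq_abs, radialCutoff, abs_of_nonneg (Real.smoothTransition.nonneg _)]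
          exact Real.smoothTransition.le_one _
        have h2 : ‖∑ b, fderiv ℝ (F b) x (stdVec b)‖ ≤ ∑ b, C b := by
          refine norm_sum_le_of_le _ fun b _ => ?_
          refine (ContinuousLinearMap.le_opNorm _ _).trans ?_
          simpa [stdVec] using hC b x hx
        calc _ ≤ 1 * ∑ b, C b := mul_le_mul h1 h2 (norm_nonneg _) zero_le_one
          _ = _ := one_mul _
      · by_cases hd : deriv Real.smoothTransition (n * (1 - ‖x‖ ^ 2) - 1) = 0
        · rw [hd, zero_mul, norm_zero]
          positivity
        -- The factor n coming from the derivative of the cutoff is harmless: x·F is Lipschitz and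
        -- vanishes on the sphere, hence is at most L(1 - |x|), and where the derivative is nonzero
        -- n(1 - |x|) ≤ 2.
        · have hle : n * (1 - ‖x‖ ^ 2) ≤ 2 := by
            by_contra! h
            exact hd (deriv_smoothTransition_of_nonpos_or (Or.inr (by linarith)))
          rw [norm_mul]
          refine mul_le_mul (hK _) ?_ (norm_nonneg _) hK0
          rw [mem_ball4] at hx
          have hb : |∑ b, x b * F b x| ≤ L * (1 - ‖x‖) := by
            by_cases hx0 : x = 0
            · subst hx0
              simpa using hL0
            · have hnx : ‖x‖ ≠ 0 := norm_ne_zero_iff.mpr hx0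
              have h1 : ‖‖x‖⁻¹ • x‖ = 1 := by simp [norm_smul, hnx]
              have h2 := hL x (mem_closedBall4.2 hx.le) (‖x‖⁻¹ • x) (mem_closedBall4.2 h1.le)
              simp only [hn _ h1, sub_zero] at h2
              refine h2.trans (mul_le_mul_of_nonneg_left ?_ hL0)
              have : x - ‖x‖⁻¹ • x = (1 - ‖x‖⁻¹) • x := by rw [sub_smul, one_smul]
              rw [this, norm_smul, Real.norm_eq_abs, ← abs_norm x, ← abs_mul, abs_norm, sub_mul,
                one_mul, inv_mul_cancel₀ hnx, abs_sub_comm, abs_of_nonneg (by linarith)]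
          have hn2 : (n : ℝ) * (1 - ‖x‖) ≤ 2 := by
            refine le_trans (mul_le_mul_of_nonneg_left ?_ (Nat.cast_nonneg _)) hle
            nlinarith [norm_nonneg x]
          simp only [norm_mul, Real.norm_eq_abs, abs_neg, Nat.abs_cast, abs_two]
          calc (n : ℝ) * (2 * |∑ b, x b * F b x|) ≤ n * (2 * (L * (1 - ‖x‖))) := by gcongr
            _ = 2 * L * (n * (1 - ‖x‖)) := by ring
            _ ≤ 2 * L * 2 := by gcongr
            _ = 4 * L := by ring
    · rw [ae_restrict_iff' isOpen_ball4.measurableSet]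
      refine Eventually.of_forall fun x hx => ?_
      apply tendsto_const_nhds.congr'
      rw [mem_ball4] at hx
      have hpos : 0 < 1 - ‖x‖ ^ 2 := by nlinarith [norm_nonneg x]
      obtain ⟨N, hN⟩ := exists_nat_gt (2 / (1 - ‖x‖ ^ 2))
      filter_upwards [eventually_ge_atTop N] with n hn'
      have h2 : 1 < n * (1 - ‖x‖ ^ 2) - 1 := by
        rw [div_lt_iff₀ hpos] at hN
        have : (N : ℝ) ≤ n := by exact_mod_cast hn'
        nlinarith
      simp only [hI]
      rw [deriv_smoothTransition_of_nonpos_or (Or.inr h2), radialCutoff,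
        Real.smoothTransition.one_of_one_le h2.le]
      ring
  refine tendsto_nhds_unique hlim (tendsto_const_nhds.congr fun n => ?_)
  rw [hzero n]

/-! ### Partial derivatives and the maximum principle -/

/-- The `a`-th partial derivative. -/
def pd (a : Fin 4) (u : R4 → ℝ) (x : R4) : ℝ := fderiv ℝ u x (stdVec a)

theorem pd_congr {a : Fin 4} {u v : R4 → ℝ} {x : R4} (h : u =ᶠ[𝓝 x] v) : pd a u x = pd a v x := by
  rw [pd, pd, h.fderiv_eq]

theorem pd_add {a : Fin 4} {u v : R4 → ℝ} {x : R4} (hu : DifferentiableAt ℝ u x)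
    (hv : DifferentiableAt ℝ v x) : pd a (fun y => u y + v y) x = pd a u x + pd a v x := by
  simp [pd, fderiv_fun_add hu hv]

theorem pd_sub {a : Fin 4} {u v : R4 → ℝ} {x : R4} (hu : DifferentiableAt ℝ u x)
    (hv : DifferentiableAt ℝ v x) : pd a (fun y => u y - v y) x = pd a u x - pd a v x := by
  simp [pd, fderiv_fun_sub hu hv]

theorem pd_mul {a : Fin 4} {u v : R4 → ℝ} {x : R4} (hu : DifferentiableAt ℝ u x)
    (hv : DifferentiableAt ℝ v x) :
    pd a (fun y => u y * v y) x = pd a u x * v x + u x * pd a v x := by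
  simp [pd, fderiv_fun_mul hu hv]
  ring

theorem pd_const (a : Fin 4) (c : ℝ) (x : R4) : pd a (fun _ => c) x = 0 := by
  simp [pd]

theorem pd_const_mul {a : Fin 4} {u : R4 → ℝ} {x : R4} (c : ℝ) (hu : DifferentiableAt ℝ u x) :
    pd a (fun y => c * u y) x = c * pd a u x := by
  rw [pd_mul (differentiableAt_const c) hu, pd_const, zero_mul, zero_add]

theorem pd_sum {ι : Type*} {s : Finset ι} {a : Fin 4} {u : ι → R4 → ℝ} {x : R4}
    (hu : ∀ i ∈ s, DifferentiableAt ℝ (u i) x) :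
    pd a (fun y => ∑ i ∈ s, u i y) x = ∑ i ∈ s, pd a (u i) x := by
  simp [pd, fderiv_fun_sum hu]

theorem pd_coord (a b : Fin 4) (x : R4) : pd a (fun y => y b) x = if b = a then 1 else 0 := by
  have : HasFDerivAt (fun y : R4 => y b) (EuclideanSpace.proj b : R4 →L[ℝ] ℝ) x :=
    (EuclideanSpace.proj b : R4 →L[ℝ] ℝ).hasFDerivAt
  rw [pd, this.fderiv]
  simp

theorem pd_norm_sq (a : Fin 4) (x : R4) : pd a (fun y => ‖y‖ ^ 2) x = 2 * x a := by
  rw [pd, (hasStrictFDerivAt_norm_sq x).hasFDerivAt.fderiv]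
  simp [inner_stdVec]

theorem contDiffAt_pd {a : Fin 4} {u : R4 → ℝ} {x : R4} {n m : WithTop ℕ∞}
    (hu : ContDiffAt ℝ n u x) (hm : m + 1 ≤ n) : ContDiffAt ℝ m (pd a u) x :=
  (hu.fderiv_right hm).clm_apply contDiffAt_const

theorem pd_pd {a b : Fin 4} {u : R4 → ℝ} {x : R4} (hu : ContDiffAt ℝ 2 u x) :
    pd a (pd b u) x = fderiv ℝ (fderiv ℝ u) x (stdVec a) (stdVec b) := by
  have h : DifferentiableAt ℝ (fderiv ℝ u) x :=
    (hu.fderiv_right (m := 1) le_rfl).differentiableAt one_ne_zero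
  change fderiv ℝ (fun y => fderiv ℝ u y (stdVec b)) x (stdVec a) = _
  rw [fderiv_clm_apply h (differentiableAt_const _)]
  simp

theorem pd_comm {a b : Fin 4} {u : R4 → ℝ} {x : R4} (hu : ContDiffAt ℝ 2 u x) :
    pd a (pd b u) x = pd b (pd a u) x := by
  rw [pd_pd hu, pd_pd hu]
  exact hu.isSymmSndFDerivAt (by simp) _ _

theorem laplacian_eq_sum_pd {u : R4 → ℝ} {x : R4} (hu : ContDiffAt ℝ 2 u x) :
    Laplacian.laplacian u x = ∑ a, pd a (pd a u) x := by
  rw [InnerProductSpace.laplacian_eq_iteratedFDeriv_orthonormalBasis u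
    (EuclideanSpace.basisFun (Fin 4) ℝ)]
  apply Finset.sum_congr rfl
  intro a _
  rw [pd_pd hu, iteratedFDeriv_two_apply]
  simp [stdVec]

theorem harmonicAt_iff {u : R4 → ℝ} {x : R4} :
    InnerProductSpace.HarmonicAt u x ↔
      ContDiffAt ℝ 2 u x ∧ ∀ᶠ y in 𝓝 x, ∑ a, pd a (pd a u) y = 0 := by
  refine and_congr_right fun h => ?_
  have h2 : ∀ᶠ y in 𝓝 x, ContDiffAt ℝ 2 u y := h.eventually (by simp)
  constructor
  · intro h1
    filter_upwards [h1, h2] with y hy1 hy2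
    rw [← laplacian_eq_sum_pd hy2, hy1]
    rfl
  · intro h1
    filter_upwards [h1, h2] with y hy1 hy2
    rw [laplacian_eq_sum_pd hy2, hy1]
    rfl

theorem hasDerivAt_line {u : R4 → ℝ} {x : R4} (a : Fin 4) (t : ℝ)
    (hu : DifferentiableAt ℝ u (x + t • stdVec a)) :
    HasDerivAt (fun s : ℝ => u (x + s • stdVec a)) (pd a u (x + t • stdVec a)) t := by
  have h1 : HasDerivAt (fun s : ℝ => x + s • stdVec a) (stdVec a) t := by
    simpa using ((hasDerivAt_id t).smul_const (stdVec a)).const_add x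
  exact hu.hasFDerivAt.comp_hasDerivAt t h1

/-- The second derivative test at a local maximum. -/
theorem pd_pd_nonpos_of_isLocalMax {u : R4 → ℝ} {x : R4} (hu : ContDiffAt ℝ 2 u x)
    (hx : IsLocalMax u x) (a : Fin 4) : pd a (pd a u) x ≤ 0 := by
  by_contra! hpos
  set g : ℝ → ℝ := fun s => u (x + s • stdVec a) with hg
  have hl : Continuous fun s : ℝ => x + s • stdVec a := by fun_prop
  have hl0 : Tendsto (fun s : ℝ => x + s • stdVec a) (𝓝 0) (𝓝 x) := by
    simpa using hl.tendsto 0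
  have hd : ∀ᶠ s in 𝓝 (0 : ℝ), HasDerivAt g (pd a u (x + s • stdVec a)) s := by
    have : ∀ᶠ y in 𝓝 x, ContDiffAt ℝ 2 u y := hu.eventually (by simp)
    filter_upwards [hl0.eventually this] with s hs
    exact hasDerivAt_line a s (hs.differentiableAt two_ne_zero)
  have hdg : deriv g =ᶠ[𝓝 0] fun s => pd a u (x + s • stdVec a) := hd.mono fun s hs => hs.deriv
  have hdd : deriv (deriv g) 0 = pd a (pd a u) x := by
    rw [hdg.deriv_eq]
    have := hasDerivAt_line (u := pd a u) (x := x) a 0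
      (by simpa using (contDiffAt_pd hu (m := 1) le_rfl).differentiableAt one_ne_zero)
    simpa using this.deriv
  have hmax : IsLocalMax g 0 := by
    have := hl0.eventually hx
    refine this.mono fun s hs => ?_
    simpa [hg] using hs
  -- A positive second derivative would make the maximum a local minimum too, so `g` would be
  -- locally constant and its second derivative zero.
  have hmin : IsLocalMin g 0 :=
    isLocalMin_of_deriv_deriv_pos (hdd ▸ hpos) hmax.deriv_eq_zero
      hd.self_of_nhds.continuousAt
  have hc : g =ᶠ[𝓝 0] fun _ => g 0 := by
    filter_upwards [hmax, hmin] with s h1 h2 using le_antisymm h1 h2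
  have : deriv g =ᶠ[𝓝 0] fun _ => 0 := hc.deriv.trans (by simp)
  rw [this.deriv_eq, deriv_const] at hdd
  linarith

/-- The weak maximum principle on the unit ball. -/
theorem nonpos_of_harmonic {u : R4 → ℝ} (hu : ∀ x ∈ ball4, ContDiffAt ℝ 2 u x)
    (hΔ : ∀ x ∈ ball4, ∑ a, pd a (pd a u) x = 0) (hc : ContinuousOn u closedBall4)
    (h0 : ∀ x : R4, ‖x‖ = 1 → u x = 0) {x : R4} (hx : x ∈ closedBall4) : u x ≤ 0 := by
  refine le_of_forall_pos_le_add fun ε hε => ?_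
  rw [zero_add]
  -- The added term has Laplacian 8ε > 0 in dimension four, which excludes an interior maximum; on
  -- the sphere `w` equals ε.
  set w : R4 → ℝ := fun y => u y + ε * ‖y‖ ^ 2 with hw
  have hwc : ContinuousOn w closedBall4 := hc.add (by fun_prop)
  obtain ⟨z, hz, hmax⟩ := isCompact_closedBall4.exists_isMaxOn ⟨x, hx⟩ hwc
  have hzx : u x + ε * ‖x‖ ^ 2 ≤ u z + ε * ‖z‖ ^ 2 := hmax hx
  by_cases hzb : z ∈ ball4
  · exfalso
    have hlm : IsLocalMax w z := hmax.isLocalMax (closedBall4_mem_nhds hzb)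
    have hns : ContDiff ℝ 2 fun y : R4 => ‖y‖ ^ 2 := contDiff_norm_sq ℝ
    have hwd : ContDiffAt ℝ 2 w z := (hu z hzb).add (contDiff_const.mul hns).contDiffAt
    have hsum : ∑ a, pd a (pd a w) z = 8 * ε := by
      have h1 : ∀ a, pd a (pd a w) z = pd a (pd a u) z + 2 * ε := by
        intro a
        have he : pd a w =ᶠ[𝓝 z] fun y => pd a u y + (2 * ε) * y a := by
          filter_upwards [isOpen_ball4.mem_nhds hzb] with y hy
          rw [hw, pd_add ((hu y hy).differentiableAt two_ne_zero)
            ((contDiff_const.mul hns).differentiable two_ne_zero y),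
            pd_const_mul _ (hns.differentiable two_ne_zero y), pd_norm_sq]
          ring
        rw [pd_congr he, pd_add ((contDiffAt_pd (hu z hzb) (m := 1) le_rfl).differentiableAt
          one_ne_zero) (by fun_prop), pd_const_mul _ (by fun_prop), pd_coord]
        simp
      simp only [h1, Finset.sum_add_distrib, hΔ z hzb]
      simp
      ring
    have : ∑ a, pd a (pd a w) z ≤ 0 :=
      Finset.sum_nonpos fun a _ => pd_pd_nonpos_of_isLocalMax hwd hlm a
    linarith
  · have hz1 : ‖z‖ = 1 := by
      rw [mem_ball4] at hzb
      rw [mem_closedBall4] at hz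
      linarith
    rw [h0 z hz1, hz1] at hzx
    nlinarith [sq_nonneg ‖x‖]

theorem eq_zero_of_harmonic {u : R4 → ℝ} (hu : ∀ x ∈ ball4, ContDiffAt ℝ 2 u x)
    (hΔ : ∀ x ∈ ball4, ∑ a, pd a (pd a u) x = 0) (hc : ContinuousOn u closedBall4)
    (h0 : ∀ x : R4, ‖x‖ = 1 → u x = 0) {x : R4} (hx : x ∈ closedBall4) : u x = 0 := by
  apply le_antisymm (nonpos_of_harmonic hu hΔ hc h0 hx)
  have hpn : ∀ a, pd a (fun y => -u y) = fun y => -pd a u y := by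
    intro a
    ext y
    simp [pd, fderiv_fun_neg]
  have hpn' : ∀ a, pd a (fun y => -pd a u y) = fun y => -pd a (pd a u) y := by
    intro a
    ext y
    rw [pd, fderiv_fun_neg]
    rfl
  have := nonpos_of_harmonic (u := fun y => -u y) (fun y hy => (hu y hy).neg)
    (fun y hy => by simp only [hpn, hpn', Finset.sum_neg_distrib, hΔ y hy, neg_zero])
    hc.neg (fun y hy => by rw [h0 y hy, neg_zero]) hx
  linarith

/-! ### The mean value property -/

/-- The mean value property on the unit ball, for functions that are smooth and harmonic on a
neighbourhood of the closed ball. -/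
theorem integral_harmonic_eq {u : R4 → ℝ} (hu : ∀ x ∈ closedBall4, ContDiffAt ℝ 3 u x)
    (hΔ : ∀ x ∈ closedBall4, ∑ a, pd a (pd a u) x = 0) :
    ∫ x in ball4, u x = volume.real ball4 * u 0 := by
  have hsm : ∀ t ∈ Icc (-1 : ℝ) 1, ∀ x ∈ closedBall4, t • x ∈ closedBall4 := by
    intro t ht x hx
    rw [mem_closedBall4] at hx ⊢
    rw [norm_smul, Real.norm_eq_abs]
    have : |t| ≤ 1 := abs_le.2 ht
    nlinarith [norm_nonneg x, abs_nonneg t]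
  have hdil : ∀ (v : R4 → ℝ) (t : ℝ) (a : Fin 4) (x : R4), DifferentiableAt ℝ v (t • x) →
      pd a (fun y => v (t • y)) x = t * pd a v (t • x) := by
    intro v t a x hv
    have h1 : HasFDerivAt (fun y : R4 => t • y) (t • ContinuousLinearMap.id ℝ R4) x :=
      (hasFDerivAt_id x).const_smul t
    have h2 : HasFDerivAt (fun y => v (t • y)) _ x := hv.hasFDerivAt.comp x h1
    rw [pd, h2.fderiv]
    simp [pd]
  have hpdc : ∀ a, ContinuousOn (pd a u) closedBall4 := fun a x hx =>
    (contDiffAt_pd (m := 2) (hu x hx) (by norm_num)).continuousAt.continuousWithinAt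
  choose C hC using fun a => isCompact_closedBall4.exists_bound_of_continuousOn (hpdc a)
  -- The integrand is the t-derivative of u(tx). The field (1 - |y|²)∇u(ty) vanishes on the sphere,
  -- and by harmonicity its divergence is -2 y·∇u(ty).
  have key : ∀ t ∈ Ioo (-1 : ℝ) 1, ∫ x in ball4, ∑ a, x a * pd a u (t • x) = 0 := by
    intro t ht
    have ht' : t ∈ Icc (-1 : ℝ) 1 := Ioo_subset_Icc_self ht
    have hF : ∀ b : Fin 4, ∀ x ∈ closedBall4,
        ContDiffAt ℝ 1 (fun y : R4 => (1 - ‖y‖ ^ 2) * pd b u (t • y)) x := by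
      intro b x hx
      apply ContDiffAt.mul
      · exact (contDiff_const.sub (contDiff_norm_sq ℝ)).contDiffAt
      · exact ContDiffAt.comp x ((contDiffAt_pd (m := 2) (hu _ (hsm t ht' x hx))
          (by norm_num)).of_le (by norm_num)) (contDiff_const_smul t).contDiffAt
    have h := integral_div_eq_zero (F := fun b y => (1 - ‖y‖ ^ 2) * pd b u (t • y))
      (fun b x hx => (hF b x hx).contDiffWithinAt) (fun x hx => by simp [hx])
    have he : ∀ x ∈ ball4, ∑ b, fderiv ℝ (fun y : R4 => (1 - ‖y‖ ^ 2) * pd b u (t • y)) x (stdVec b)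
        = -2 * ∑ a, x a * pd a u (t • x) := by
      intro x hx
      have hxt := hsm t ht' x (ball4_subset_closedBall4 hx)
      have hn : DifferentiableAt ℝ (fun y : R4 => ‖y‖ ^ 2) x :=
        (contDiff_norm_sq ℝ (n := 1)).differentiable one_ne_zero x
      have hp : ∀ b, DifferentiableAt ℝ (pd b u) (t • x) := fun b =>
        (contDiffAt_pd (m := 2) (hu _ hxt) (by norm_num)).differentiableAt two_ne_zero
      have : ∀ b, fderiv ℝ (fun y : R4 => (1 - ‖y‖ ^ 2) * pd b u (t • y)) x (stdVec b) =
          -2 * (x b * pd b u (t • x)) + (1 - ‖x‖ ^ 2) * t * pd b (pd b u) (t • x) := by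
        intro b
        change pd b _ x = _
        have hp' : DifferentiableAt ℝ (fun y : R4 => pd b u (t • y)) x :=
          DifferentiableAt.comp x (hp b) (by fun_prop)
        rw [pd_mul (u := fun y : R4 => 1 - ‖y‖ ^ 2) ((differentiableAt_const _).sub hn) hp', hdil _ _ _ _ (hp b),
          pd_sub (differentiableAt_const _) hn, pd_const, pd_norm_sq]
        ring
      simp only [this, Finset.sum_add_distrib, ← Finset.mul_sum, hΔ _ hxt]
      simp
    rw [setIntegral_congr_fun isOpen_ball4.measurableSet he, integral_const_mul] at h
    linarith [h]
  have hcont : ContinuousOn u closedBall4 := fun x hx => (hu x hx).continuousAt.continuousWithinAt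
  obtain ⟨C0, hC0⟩ := isCompact_closedBall4.exists_bound_of_continuousOn hcont
  have hmeas : ∀ t ∈ Icc (-1 : ℝ) 1, AEStronglyMeasurable (fun x => u (t • x))
      (volume.restrict ball4) := by
    intro t ht
    apply ContinuousOn.aestronglyMeasurable _ isOpen_ball4.measurableSet
    exact hcont.comp (by fun_prop) fun x hx => hsm t ht x (ball4_subset_closedBall4 hx)
  have hderiv : ∀ t ∈ Ioo (-1 : ℝ) 1,
      HasDerivAt (fun t => ∫ x in ball4, u (t • x)) 0 t := by
    intro t ht
    rw [← key t ht]
    have hmem : Ioo (-1 : ℝ) 1 ∈ 𝓝 t := isOpen_Ioo.mem_nhds ht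
    refine (hasDerivAt_integral_of_dominated_loc_of_deriv_le
      (F' := fun t x => ∑ a, x a * pd a u (t • x)) (bound := fun _ => ∑ a, C a) hmem
      ?_ ?_ ?_ ?_ ?_ ?_).2
    · filter_upwards [hmem] with s hs using hmeas s (Ioo_subset_Icc_self hs)
    · refine Integrable.mono' (g := fun _ => C0) (integrableOn_const volume_ball4_lt_top.ne)
        (hmeas t (Ioo_subset_Icc_self ht)) ?_
      rw [ae_restrict_iff' isOpen_ball4.measurableSet]
      exact Eventually.of_forall fun x hx =>
        hC0 _ (hsm t (Ioo_subset_Icc_self ht) x (ball4_subset_closedBall4 hx))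
    · apply ContinuousOn.aestronglyMeasurable _ isOpen_ball4.measurableSet
      apply continuousOn_finsetSum
      intro a _
      apply ContinuousOn.mul (by fun_prop)
      exact (hpdc a).comp (by fun_prop)
        fun x hx => hsm t (Ioo_subset_Icc_self ht) x (ball4_subset_closedBall4 hx)
    · rw [ae_restrict_iff' isOpen_ball4.measurableSet]
      refine Eventually.of_forall fun x hx s hs => ?_
      refine norm_sum_le_of_le _ fun a _ => ?_
      rw [norm_mul]
      have h1 : ‖x a‖ ≤ 1 := (PiLp.norm_apply_le x a).trans (mem_ball4.1 hx).le
      have h2 := hC a _ (hsm s (Ioo_subset_Icc_self hs) x (ball4_subset_closedBall4 hx))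
      nlinarith [norm_nonneg (x a), norm_nonneg (pd a u (s • x))]
    · exact integrableOn_const volume_ball4_lt_top.ne
    · rw [ae_restrict_iff' isOpen_ball4.measurableSet]
      refine Eventually.of_forall fun x hx s hs => ?_
      have hd : DifferentiableAt ℝ u (s • x) := (hu _ (hsm s (Ioo_subset_Icc_self hs) x
        (ball4_subset_closedBall4 hx))).differentiableAt three_ne_zero
      have h1 : HasDerivAt (fun s : ℝ => s • x) x s := by
        simpa using (hasDerivAt_id s).smul_const x
      have h2 : HasDerivAt (fun s : ℝ => u (s • x)) _ s := hd.hasFDerivAt.comp_hasDerivAt s h1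
      have h3 : fderiv ℝ u (s • x) x = ∑ a, x a * pd a u (s • x) := by
        conv_lhs => rw [← sum_smul_stdVec x, map_sum]
        simp [pd, sum_smul_stdVec]
      rwa [← h3]
  have hconst : ∀ t ∈ Ico (0 : ℝ) 1, ∫ x in ball4, u (t • x) = volume.real ball4 * u 0 := by
    intro t ht
    have := (convex_Ioo (-1 : ℝ) 1).is_const_of_fderivWithin_eq_zero (𝕜 := ℝ)
      (f := fun t => ∫ x in ball4, u (t • x))
      (fun s hs => (hderiv s hs).differentiableAt.differentiableWithinAt)
      (fun s hs => by
        rw [fderivWithin_of_isOpen isOpen_Ioo hs]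
        ext
        simp [(hderiv s hs).deriv])
      (x := t) (y := 0) ⟨by linarith [ht.1], ht.2⟩ ⟨by norm_num, by norm_num⟩
    rw [this]
    simp [mul_comm]
  -- Constancy in t is known only on an open interval, chosen symmetric so that t = 0 is interior;
  -- the value t = 1 is reached as a limit.
  have hlim : Tendsto (fun n : ℕ => ∫ x in ball4, u ((1 - 1 / ((n : ℝ) + 1)) • x)) atTop
      (𝓝 (∫ x in ball4, u x)) := by
    have hI : ∀ n : ℕ, (1 - 1 / ((n : ℝ) + 1)) ∈ Icc (-1 : ℝ) 1 := by
      intro n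
      have h1 : 0 < 1 / ((n : ℝ) + 1) := Nat.one_div_pos_of_nat
      have h2 : 1 / ((n : ℝ) + 1) ≤ 1 := by
        rw [div_le_one (by positivity)]
        linarith [Nat.cast_nonneg (α := ℝ) n]
      constructor <;> linarith
    apply tendsto_integral_of_dominated_convergence (fun _ => C0)
    · exact fun n => hmeas _ (hI n)
    · exact integrableOn_const volume_ball4_lt_top.ne
    · intro n
      rw [ae_restrict_iff' isOpen_ball4.measurableSet]
      exact Eventually.of_forall fun x hx => hC0 _ (hsm _ (hI n) x (ball4_subset_closedBall4 hx))
    · rw [ae_restrict_iff' isOpen_ball4.measurableSet]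
      refine Eventually.of_forall fun x hx => ?_
      have h1 : Tendsto (fun n : ℕ => (1 - 1 / ((n : ℝ) + 1)) • x) atTop (𝓝 x) := by
        have := (tendsto_const_nhds (x := (1 : ℝ))).sub
          (tendsto_one_div_add_atTop_nhds_zero_nat (𝕜 := ℝ))
        simpa using this.smul_const x
      exact (hu x (ball4_subset_closedBall4 hx)).continuousAt.tendsto.comp h1
  refine tendsto_nhds_unique hlim (tendsto_const_nhds.congr fun n => ?_)
  rw [hconst]
  have h1 : 0 < 1 / ((n : ℝ) + 1) := Nat.one_div_pos_of_nat
  have h2 : 1 / ((n : ℝ) + 1) ≤ 1 := by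
    rw [div_le_one (by positivity)]
    linarith [Nat.cast_nonneg (α := ℝ) n]
  constructor <;> linarith

/-! ### Components of forms, and Im(ȳv) in coordinates -/

/-- The component `A_{l,b}` of a Lie algebra valued 1-form. -/
def component (A : OneForm) (l : Fin 3) (b : Fin 4) (x : R4) : ℝ := A x (stdVec b) l

/-- The continuous linear functional that takes a component. -/
def componentCLM (l : Fin 3) (b : Fin 4) : (R4 →L[ℝ] LieAlg) →L[ℝ] ℝ :=
  (EuclideanSpace.proj l : LieAlg →L[ℝ] ℝ).comp (ContinuousLinearMap.apply ℝ LieAlg (stdVec b))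

@[simp] theorem componentCLM_apply (l : Fin 3) (b : Fin 4) (T : R4 →L[ℝ] LieAlg) :
    componentCLM l b T = T (stdVec b) l := rfl

theorem form_ext {S T : R4 →L[ℝ] LieAlg} (h : ∀ l b, S (stdVec b) l = T (stdVec b) l) : S = T := by
  ext v l
  rw [← sum_smul_stdVec v]
  simp [map_sum, map_smul, h]

theorem infty_ge (n : ℕ) : (n : WithTop ℕ∞) ≤ ∞ := mod_cast le_top

theorem extDCoeff_eq {A : OneForm} {x : R4} (hA : DifferentiableAt ℝ A x) (l : Fin 3)
    (a b : Fin 4) :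
    extDCoeff A l x a b = pd a (component A l b) x - pd b (component A l a) x := by
  have hc : ∀ c : R4, DifferentiableAt ℝ (fun y => A y c) x := fun c =>
    hA.clm_apply (differentiableAt_const c)
  have h1 : DifferentiableAt ℝ
      (fun y => ContinuousAlternatingMap.ofSubsingleton ℝ R4 LieAlg (0 : Fin 1) (A y)) x :=
    (LinearIsometryEquiv.differentiableAt
      (ContinuousAlternatingMap.ofSubsingletonLIE (𝕜 := ℝ) (E := R4) (F := LieAlg)
        (0 : Fin 1))).comp x hA
  have h2 : ∀ c d : Fin 4, (fderiv ℝ (fun y => A y (stdVec c)) x (stdVec d)) l =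
      pd d (component A l c) x := by
    intro c d
    have := ((EuclideanSpace.proj l : LieAlg →L[ℝ] ℝ).hasFDerivAt.comp x (hc (stdVec c)).hasFDerivAt)
    have h3 : component A l c = (EuclideanSpace.proj l : LieAlg →L[ℝ] ℝ) ∘ fun y => A y (stdVec c) :=
      rfl
    rw [pd, h3, this.fderiv]
    rfl
  rw [extDCoeff, extD, extDeriv_apply h1, Fin.sum_univ_two]
  simp [Fin.removeNth, ← h2, sub_eq_add_neg]

theorem imPart_star_mul (y v : R4) : imPart (star (toQuat y) * toQuat v) =
    !₂[y 0 * v 1 - y 1 * v 0 - y 2 * v 3 + y 3 * v 2, y 0 * v 2 + y 1 * v 3 - y 2 * v 0 - y 3 * v 1,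
      y 0 * v 3 - y 1 * v 2 + y 2 * v 1 - y 3 * v 0] := by
  have h0 : ∀ x : R4, (toQuat x).re = x 0 := fun _ => rfl
  have h1 : ∀ x : R4, (toQuat x).imI = x 1 := fun _ => rfl
  have h2 : ∀ x : R4, (toQuat x).imJ = x 2 := fun _ => rfl
  have h3 : ∀ x : R4, (toQuat x).imK = x 3 := fun _ => rfl
  ext l
  fin_cases l <;> simp [imPart, h0, h1, h2, h3] <;> ring

/-- `imPart (star y * v)` as a linear function of `v`, where `y` is a basis quaternion. -/
def quatForm (c : Fin 4) : R4 →L[ℝ] LieAlg :=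
  LinearMap.toContinuousLinearMap
    { toFun := fun v => imPart (star (toQuat (stdVec c)) * toQuat v)
      map_add' := fun v w => by
        ext l
        fin_cases l <;> simp [imPart_star_mul, -stdVec_apply] <;> ring
      map_smul' := fun t v => by
        ext l
        fin_cases l <;> simp [imPart_star_mul, -stdVec_apply] <;> ring }

theorem quatForm_apply (c : Fin 4) (v : R4) :
    quatForm c v = imPart (star (toQuat (stdVec c)) * toQuat v) := rfl

theorem sum_smul_quatForm (y v : R4) :
    ∑ c, y c • quatForm c v = imPart (star (toQuat y) * toQuat v) := by
  ext l
  fin_cases l <;> simp [quatForm_apply, imPart_star_mul, Fin.sum_univ_four] <;> ring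

/-! ### The harmonic form h_p as a Kelvin transform -/

/-- The denominator `|x|² |x / |x|² - p|²` of the Kelvin transform. -/
def kelvinDen (p x : R4) : ℝ := 1 - 2 * ∑ a, p a * x a + (∑ a, p a ^ 2) * ∑ a, x a ^ 2

/-- The Kelvin transform of the function `(x_c - p_c) / |x - p|⁴`. -/
def kelvin (p : R4) (c : Fin 4) (x : R4) : ℝ :=
  (x c - (∑ a, x a ^ 2) * p c) * (kelvinDen p x)⁻¹ ^ 2

/-- By Cauchy–Schwarz the denominator is at least (1 - |p||x|)². Inversion moves the pole p out of
the closed ball. -/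
theorem kelvinDen_pos {p x : R4} (hp : p ∈ ball4) (hx : x ∈ closedBall4) : 0 < kelvinDen p x := by
  rw [mem_ball4] at hp
  rw [mem_closedBall4] at hx
  have h1 : ∑ a, p a * x a ≤ ‖p‖ * ‖x‖ := by
    rw [← inner_eq_sum]
    exact real_inner_le_norm p x
  rw [kelvinDen, ← norm_sq_eq_sum, ← norm_sq_eq_sum]
  have h2 : ‖p‖ * ‖x‖ < 1 := by nlinarith [norm_nonneg p, norm_nonneg x]
  nlinarith [mul_pos (sub_pos.2 h2) (sub_pos.2 h2)]

theorem contDiff_kelvinDen (p : R4) : ContDiff ℝ ∞ (kelvinDen p) := by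
  unfold kelvinDen
  fun_prop

theorem contDiff_kelvinNum (p : R4) (c : Fin 4) :
    ContDiff ℝ ∞ (fun x : R4 => x c - (∑ a, x a ^ 2) * p c) := by
  fun_prop

theorem contDiffAt_kelvin (p : R4) (c : Fin 4) {x : R4} (hx : kelvinDen p x ≠ 0) :
    ContDiffAt ℝ ∞ (kelvin p c) x :=
  (contDiff_kelvinNum p c).contDiffAt.mul (((contDiff_kelvinDen p).contDiffAt.inv hx).pow 2)

theorem pd_sum_sq (a : Fin 4) (x : R4) : pd a (fun y => ∑ b, y b ^ 2) x = 2 * x a := by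
  simp only [← norm_sq_eq_sum, pd_norm_sq]

theorem pd_kelvinDen (p : R4) (a : Fin 4) (x : R4) :
    pd a (kelvinDen p) x = -2 * p a + (∑ b, p b ^ 2) * (2 * x a) := by
  unfold kelvinDen
  rw [pd_add (by fun_prop) (by fun_prop), pd_sub (by fun_prop) (by fun_prop), pd_const,
    pd_const_mul _ (by fun_prop), pd_const_mul _ (by fun_prop), pd_sum_sq,
    pd_sum (fun i _ => by fun_prop)]
  have h : ∀ b, pd a (fun y : R4 => p b * y b) x = p b * if b = a then 1 else 0 := fun b => by
    rw [pd_const_mul _ (by fun_prop), pd_coord]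
  simp [h]

theorem pd_inv {a : Fin 4} {u : R4 → ℝ} {x : R4} (hu : DifferentiableAt ℝ u x) (hx : u x ≠ 0) :
    pd a (fun y => (u y)⁻¹) x = -pd a u x * (u x)⁻¹ ^ 2 := by
  have := (hasDerivAt_inv hx).comp_hasFDerivAt x hu.hasFDerivAt
  have h2 : (fun y => (u y)⁻¹) = Inv.inv ∘ u := rfl
  rw [pd, h2, this.fderiv]
  simp [pd]
  ring

theorem pd_pow {a : Fin 4} {u : R4 → ℝ} {x : R4} (n : ℕ) (hu : DifferentiableAt ℝ u x) :
    pd a (fun y => u y ^ n) x = n * u x ^ (n - 1) * pd a u x := by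
  rw [pd, (hu.hasFDerivAt.pow n).fderiv]
  simp [pd]

theorem pd_kelvinNum (p : R4) (a c : Fin 4) (x : R4) :
    pd a (fun x => x c - (∑ a, x a ^ 2) * p c) x = (if c = a then 1 else 0) - 2 * x a * p c := by
  rw [pd_sub (by fun_prop) (by fun_prop), pd_coord, pd_mul (by fun_prop) (by fun_prop), pd_sum_sq,
    pd_const]
  simp

theorem pd_kelvin (p : R4) (a c : Fin 4) {x : R4} (hx : kelvinDen p x ≠ 0) :
    pd a (kelvin p c) x = ((if c = a then 1 else 0) - 2 * x a * p c) * (kelvinDen p x)⁻¹ ^ 2 +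
      (x c - (∑ a, x a ^ 2) * p c) *
        (-2 * (kelvinDen p x)⁻¹ ^ 3 * (-2 * p a + (∑ b, p b ^ 2) * (2 * x a))) := by
  have hd : DifferentiableAt ℝ (kelvinDen p) x := (contDiff_kelvinDen p).differentiable (by simp) x
  have hi : DifferentiableAt ℝ (fun x => (kelvinDen p x)⁻¹) x := hd.inv hx
  have hi2 : DifferentiableAt ℝ (fun x => (kelvinDen p x)⁻¹ ^ 2) x := hi.pow 2
  unfold kelvin
  rw [pd_mul (by fun_prop) hi2, pd_kelvinNum, pd_pow 2 hi, pd_inv hd hx, pd_kelvinDen]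
  push_cast
  ring

/-- (y_c - p_c)/|y - p|⁴ is up to a factor a derivative of the fundamental solution |y - p|⁻², and
the Kelvin transform preserves harmonicity. The verification is a direct computation with numerator
N and denominator D. -/
theorem sum_pd_pd_kelvin (p : R4) (c : Fin 4) {x : R4} (hx : kelvinDen p x ≠ 0) :
    ∑ a, pd a (pd a (kelvin p c)) x = 0 := by
  have hd : DifferentiableAt ℝ (kelvinDen p) x := (contDiff_kelvinDen p).differentiable (by simp) x
  have hi : DifferentiableAt ℝ (fun x => (kelvinDen p x)⁻¹) x := hd.inv hx
  have h1 : ∀ a, pd a (pd a (kelvin p c)) x =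
      -2 * p c * (kelvinDen p x)⁻¹ ^ 2 + 2 * ((if c = a then 1 else 0) - 2 * x a * p c) *
        (-2 * (kelvinDen p x)⁻¹ ^ 3 * (-2 * p a + (∑ b, p b ^ 2) * (2 * x a))) +
      (x c - (∑ a, x a ^ 2) * p c) *
        (6 * (kelvinDen p x)⁻¹ ^ 4 * (-2 * p a + (∑ b, p b ^ 2) * (2 * x a)) ^ 2
          - 4 * (∑ b, p b ^ 2) * (kelvinDen p x)⁻¹ ^ 3) := by
    intro a
    have he : pd a (kelvin p c) =ᶠ[𝓝 x] fun x =>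
      ((if c = a then 1 else 0) - 2 * x a * p c) * (kelvinDen p x)⁻¹ ^ 2 +
      (x c - (∑ a, x a ^ 2) * p c) *
        (-2 * (kelvinDen p x)⁻¹ ^ 3 * (-2 * p a + (∑ b, p b ^ 2) * (2 * x a))) := by
      filter_upwards [(contDiff_kelvinDen p).continuous.continuousAt.eventually_ne hx] with y hy
      exact pd_kelvin p a c hy
    have d1 : DifferentiableAt ℝ (fun x => (kelvinDen p x)⁻¹ ^ 2) x := hi.pow 2
    have d2 : DifferentiableAt ℝ (fun x => (kelvinDen p x)⁻¹ ^ 3) x := hi.pow 3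
    have e1 : pd a (fun x : R4 => (if c = a then (1 : ℝ) else 0) - 2 * x a * p c) x
        = -2 * p c := by
      rw [pd_sub (by fun_prop) (by fun_prop), pd_const, pd_mul (by fun_prop) (by fun_prop),
        pd_const, pd_const_mul _ (by fun_prop), pd_coord]
      simp
    have e2 : pd a (fun x : R4 => -2 * p a + (∑ b, p b ^ 2) * (2 * x a)) x
        = 2 * (∑ b, p b ^ 2) := by
      rw [pd_add (by fun_prop) (by fun_prop), pd_const, pd_const_mul _ (by fun_prop),
        pd_const_mul _ (by fun_prop), pd_coord]
      simp
      ring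
    rw [pd_congr he, pd_add (by fun_prop) (by fun_prop), pd_mul (by fun_prop) d1,
      pd_mul (by fun_prop) (by fun_prop), pd_kelvinNum, pd_mul (by fun_prop) (by fun_prop),
      pd_const_mul _ d2, e1, e2, pd_pow 2 hi, pd_pow 3 hi, pd_inv hd hx, pd_kelvinDen]
    push_cast
    ring
  simp only [h1]
  obtain ⟨w, hw⟩ : ∃ w, w = (kelvinDen p x)⁻¹ := ⟨_, rfl⟩
  have hwQ : w * kelvinDen p x = 1 := by rw [hw, inv_mul_cancel₀ hx]
  rw [← hw]
  rw [kelvinDen] at hwQ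
  -- The two identities that make everything cancel: ∇N·∇D = 2(|p|²N - p_c D) here, and |∇D|² =
  -- 4|p|²D in `e4`. What remains uses only wD = 1.
  have e3 : ∑ a, (2 * ((if c = a then (1 : ℝ) else 0) - 2 * x a * p c) *
      (-2 * w ^ 3 * (-2 * p a + (∑ b, p b ^ 2) * (2 * x a)))) =
      -4 * w ^ 3 * (-2 * p c * (1 - 2 * ∑ a, p a * x a + (∑ a, p a ^ 2) * ∑ a, x a ^ 2) +
        2 * (∑ b, p b ^ 2) * (x c - (∑ a, x a ^ 2) * p c)) := by
    fin_cases c <;> simp [Fin.sum_univ_four] <;> ring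
  have e4 : ∑ a, (-2 * p a + (∑ b, p b ^ 2) * (2 * x a)) ^ 2 = 4 * (∑ b, p b ^ 2) *
      (1 - 2 * ∑ a, p a * x a + (∑ a, p a ^ 2) * ∑ a, x a ^ 2) := by
    simp only [Fin.sum_univ_four]
    ring
  rw [Finset.sum_add_distrib, Finset.sum_add_distrib, e3, ← Finset.mul_sum,
    ← Finset.mul_sum, Finset.sum_sub_distrib, ← Finset.mul_sum, e4]
  simp only [Finset.sum_const, Finset.card_univ, Fintype.card_fin, nsmul_eq_mul]
  push_cast
  generalize (1 - 2 * ∑ a, p a * x a + (∑ a, p a ^ 2) * ∑ a, x a ^ 2) = Q at hwQ ⊢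
  generalize (x c - (∑ a, x a ^ 2) * p c) = N
  generalize ∑ b, p b ^ 2 = P
  linear_combination (8 * w ^ 2 * p c + 24 * N * P * w ^ 3) * hwQ

/-- The harmonic form `h_p`, given by a Kelvin transform. -/
def harmonicForm (p : R4) : OneForm := fun x => ∑ c, kelvin p c x • quatForm c

theorem contDiffAt_harmonicForm (p : R4) {x : R4} (hx : kelvinDen p x ≠ 0) :
    ContDiffAt ℝ ∞ (harmonicForm p) x :=
  ContDiffAt.sum fun c _ => (contDiffAt_kelvin p c hx).smul contDiffAt_const

theorem harmonicAt_kelvin (p : R4) (c : Fin 4) {x : R4} (hx : kelvinDen p x ≠ 0) :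
    InnerProductSpace.HarmonicAt (kelvin p c) x := by
  refine harmonicAt_iff.2 ⟨(contDiffAt_kelvin p c hx).of_le (infty_ge 2), ?_⟩
  filter_upwards [(contDiff_kelvinDen p).continuous.continuousAt.eventually_ne hx] with y hy
  exact sum_pd_pd_kelvin p c hy

theorem isHarmonicForm_harmonicForm {p : R4} (hp : p ∈ ball4) :
    IsHarmonicForm p (harmonicForm p) := by
  refine ⟨fun x hx => ?_, fun x hx => ?_, fun x v => ?_⟩
  · have hx' := (kelvinDen_pos hp (ball4_subset_closedBall4 hx)).ne'
    have h : ∀ c, InnerProductSpace.HarmonicAt (fun x => kelvin p c x • quatForm c) x := fun c =>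
      (harmonicAt_kelvin p c hx').comp_CLM
        (ContinuousLinearMap.toSpanSingleton ℝ (quatForm c))
    have he : harmonicForm p = (fun x => kelvin p 0 x • quatForm 0) +
        (fun x => kelvin p 1 x • quatForm 1) + (fun x => kelvin p 2 x • quatForm 2) +
        (fun x => kelvin p 3 x • quatForm 3) := by
      funext x
      simp [harmonicForm, Fin.sum_univ_four]
    rw [he]
    exact (((h 0).add (h 1)).add (h 2)).add (h 3)
  · exact (contDiffAt_harmonicForm p (kelvinDen_pos hp hx).ne').continuousAt.continuousWithinAt
  · have hx1 : ∑ a, (x : R4) a ^ 2 = 1 := by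
      rw [← norm_sq_eq_sum]
      simp
    -- On the unit sphere inversion is the identity, so the Kelvin transform keeps the prescribed
    -- boundary values.
    have hQ : kelvinDen p x = ‖(x : R4) - p‖ ^ 2 := by
      rw [norm_sq_eq_sum, kelvinDen]
      simp only [Fin.sum_univ_four, PiLp.sub_apply] at hx1 ⊢
      linear_combination (p 0 ^ 2 + p 1 ^ 2 + p 2 ^ 2 + p 3 ^ 2 - 1) * hx1
    rw [← sum_smul_quatForm, Finset.smul_sum]
    simp only [harmonicForm, sum_apply, smul_apply]
    refine Finset.sum_congr rfl fun c _ => ?_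
    rw [kelvin, hQ, hx1, one_mul, smul_smul, PiLp.sub_apply, ← inv_pow, ← pow_mul, mul_comm, inv_pow]

/-- The maximum principle applies to each component of the difference, since all components, not
only the tangential ones, are prescribed on the sphere. -/
theorem IsHarmonicForm.eq_harmonicForm {p : R4} (hp : p ∈ ball4) {h : OneForm}
    (hh : IsHarmonicForm p h) {x : R4} (hx : x ∈ closedBall4) : h x = harmonicForm p x := by
  obtain ⟨h1, h2, h3⟩ := hh
  obtain ⟨k1, k2, k3⟩ := isHarmonicForm_harmonicForm hp
  refine form_ext fun l b => ?_
  have hH : ∀ x ∈ ball4, InnerProductSpace.HarmonicAt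
      (componentCLM l b ∘ (h - harmonicForm p)) x :=
    fun x hx => ((h1 x hx).sub (k1 x hx)).comp_CLM _
  have := eq_zero_of_harmonic (u := componentCLM l b ∘ (h - harmonicForm p))
    (fun x hx => (harmonicAt_iff.1 (hH x hx)).1)
    (fun x hx => (harmonicAt_iff.1 (hH x hx)).2.self_of_nhds)
    ((componentCLM l b).continuous.comp_continuousOn (h2.sub k2))
    (fun y hy => by
      have e1 := h3 ⟨y, by simpa using hy⟩ (stdVec b)
      have e2 := k3 ⟨y, by simpa using hy⟩ (stdVec b)
      simp only at e1 e2
      simp [e1, e2]) hx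
  simpa [sub_eq_zero] using this

theorem extDCoeff_congr {A B : OneForm} {x : R4} (h : A =ᶠ[𝓝 x] B) (l : Fin 3) :
    extDCoeff A l x = extDCoeff B l x := by
  funext a b
  rw [extDCoeff, extDCoeff, extD, extD]
  have : (fun y => ContinuousAlternatingMap.ofSubsingleton ℝ R4 LieAlg (0 : Fin 1) (A y)) =ᶠ[𝓝 x]
      fun y => ContinuousAlternatingMap.ofSubsingleton ℝ R4 LieAlg (0 : Fin 1) (B y) := by
    filter_upwards [h] with y hy
    rw [hy]
  rw [this.extDeriv_eq]

theorem IsHarmonicForm.extDCoeff_eq {p : R4} (hp : p ∈ ball4) {h : OneForm}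
    (hh : IsHarmonicForm p h) {x : R4} (hx : x ∈ ball4) (i : Fin 3) :
    extDCoeff h i x = extDCoeff (harmonicForm p) i x := by
  apply extDCoeff_congr
  filter_upwards [isOpen_ball4.mem_nhds hx] with y hy
  exact hh.eq_harmonicForm hp (ball4_subset_closedBall4 hy)

/-- A derivative of a harmonic function is harmonic, here on a neighbourhood of the closed ball, so
the mean value property applies. At the origin the denominator is 1 and the derivative is δ_{ac},
whatever p is. -/
theorem integral_pd_kelvin {p : R4} (hp : p ∈ ball4) (a c : Fin 4) :
    ∫ x in ball4, pd a (kelvin p c) x = if c = a then volume.real ball4 else 0 := by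
  have hc : ∀ x ∈ closedBall4, ContDiffAt ℝ ∞ (kelvin p c) x := fun x hx =>
    contDiffAt_kelvin p c (kelvinDen_pos hp hx).ne'
  have hopen : ∀ x ∈ closedBall4, ∀ᶠ y in 𝓝 x, kelvinDen p y ≠ 0 := fun x hx =>
    (contDiff_kelvinDen p).continuous.continuousAt.eventually_ne (kelvinDen_pos hp hx).ne'
  rw [integral_harmonic_eq (u := pd a (kelvin p c))
    (fun x hx => contDiffAt_pd (n := 4) ((hc x hx).of_le (infty_ge 4)) (by norm_num))]
  · rw [pd_kelvin p a c (kelvinDen_pos hp (by simp [closedBall4])).ne']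
    simp [kelvinDen]
  · intro x hx
    have h2 : ∀ b, pd b (pd b (pd a (kelvin p c))) x = pd a (pd b (pd b (kelvin p c))) x := by
      intro b
      have h3 : pd b (pd a (kelvin p c)) =ᶠ[𝓝 x] pd a (pd b (kelvin p c)) := by
        filter_upwards [hopen x hx] with y hy
        exact pd_comm ((contDiffAt_kelvin p c hy).of_le (infty_ge 2))
      rw [pd_congr h3]
      exact pd_comm (contDiffAt_pd (n := 3) ((hc x hx).of_le (infty_ge 3))
        (by norm_num))
    have h4 : (fun y => ∑ b, pd b (pd b (kelvin p c)) y) =ᶠ[𝓝 x] fun _ => 0 := by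
      filter_upwards [hopen x hx] with y hy
      exact sum_pd_pd_kelvin p c hy
    simp only [h2]
    rw [← pd_sum, pd_congr h4, pd_const]
    intro b _
    have h5 : ContDiffAt ℝ 2 (pd b (kelvin p c)) x :=
      contDiffAt_pd (n := 3) ((hc x hx).of_le (infty_ge 3)) (by norm_num)
    exact (contDiffAt_pd h5 (m := 1) (by norm_num)).differentiableAt one_ne_zero

/-! ### Uniqueness of dA for the linear Dirichlet problem -/

/-- A 1-form with vanishing tangential part on the unit sphere that solves `d*du = 0` is closed. -/
theorem ae_closed_of_coclosed {u : Fin 4 → R4 → ℝ} (hu : ∀ a, ContDiffOn ℝ 2 (u a) closedBall4)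
    (ht : ∀ x : R4, ‖x‖ = 1 → ∃ c, ∀ a, u a x = c * x a)
    (hd : ∀ x ∈ ball4, ∀ b, ∑ a, pd a (fun y => pd a (u b) y - pd b (u a) y) x = 0) :
    ∀ᵐ x ∂(volume.restrict ball4), ∀ a b, pd a (u b) x - pd b (u a) x = 0 := by
  -- `fderivWithin` makes the curl C¹ up to the boundary; inside the ball it is the usual one.
  set W : Fin 4 → Fin 4 → R4 → ℝ := fun a b x => fderivWithin ℝ (u b) closedBall4 x (stdVec a) -
    fderivWithin ℝ (u a) closedBall4 x (stdVec b) with hW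
  have hWs : ∀ a b x, W a b x = -W b a x := fun a b x => by simp [hW]
  have hWc : ∀ a b, ContDiffOn ℝ 1 (W a b) closedBall4 := by
    intro a b
    have h : ∀ c d, ContDiffOn ℝ 1
        (fun x => fderivWithin ℝ (u c) closedBall4 x (stdVec d)) closedBall4 := fun c d =>
      ((hu c).fderivWithin uniqueDiffOn_closedBall4 (by norm_num)).clm_apply contDiffOn_const
    exact (h b a).sub (h a b)
  have hWe : ∀ x ∈ ball4, ∀ a b, W a b x = pd a (u b) x - pd b (u a) x := by
    intro x hx a b
    simp only [hW, fderivWithin_of_mem_nhds (closedBall4_mem_nhds hx), pd]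
  have hWp : ∀ x ∈ ball4, ∀ a, ∑ b, pd b (W a b) x = 0 := by
    intro x hx a
    have h1 : ∀ b, pd b (W a b) x = -pd b (fun y => pd b (u a) y - pd a (u b) y) x := by
      intro b
      have : W a b =ᶠ[𝓝 x] fun y => -(pd b (u a) y - pd a (u b) y) := by
        filter_upwards [isOpen_ball4.mem_nhds hx] with y hy
        rw [hWe y hy]
        ring
      rw [pd_congr this, pd, fderiv_fun_neg]
      rfl
    simp only [h1, Finset.sum_neg_distrib, hd x hx a, neg_zero]
  -- Energy identity: on the sphere u is a multiple of x, so this field is tangential by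
  -- antisymmetry of W. Since W is coclosed, its divergence is -½ ∑ W_{ab}², whose integral must
  -- vanish.
  have hF : ∀ b, ContDiffOn ℝ 1 (fun x => ∑ a, u a x * W a b x) closedBall4 := fun b =>
    ContDiffOn.sum fun a _ => ((hu a).of_le (by norm_num)).mul (hWc a b)
  have hanti : ∀ v : Fin 4 → ℝ, ∀ x, ∑ b, v b * ∑ a, v a * W a b x = 0 := by
    intro v x
    have h1 : ∑ b, v b * ∑ a, v a * W a b x = ∑ b, ∑ a, v b * v a * W a b x := by
      simp only [Finset.mul_sum, mul_assoc]
    have h2 : ∑ b, ∑ a, v b * v a * W a b x = -∑ b, ∑ a, v b * v a * W a b x := by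
      conv_lhs => rw [Finset.sum_comm]
      simp only [← Finset.sum_neg_distrib]
      refine Finset.sum_congr rfl fun a _ => Finset.sum_congr rfl fun b _ => ?_
      rw [hWs a b]
      ring
    rw [h1]
    linarith
  have hint := integral_div_eq_zero (F := fun b x => ∑ a, u a x * W a b x) hF (fun x hx => by
    obtain ⟨c, hc⟩ := ht x hx
    have := hanti (fun a => x a) x
    calc ∑ b, x b * ∑ a, u a x * W a b x = c * ∑ b, x b * ∑ a, x a * W a b x := by
          simp only [hc, Finset.mul_sum]
          refine Finset.sum_congr rfl fun a _ => Finset.sum_congr rfl fun b _ => ?_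
          ring
      _ = 0 := by rw [this, mul_zero])
  have hdiv : ∀ x ∈ ball4, ∑ b, fderiv ℝ (fun x => ∑ a, u a x * W a b x) x (stdVec b) =
      -(1 / 2) * ∑ b, ∑ a, W a b x ^ 2 := by
    intro x hx
    have hud : ∀ a, DifferentiableAt ℝ (u a) x := fun a =>
      ((hu a).contDiffAt (closedBall4_mem_nhds hx)).differentiableAt two_ne_zero
    have hWd : ∀ a b, DifferentiableAt ℝ (W a b) x := fun a b =>
      ((hWc a b).contDiffAt (closedBall4_mem_nhds hx)).differentiableAt one_ne_zero
    have h1 : ∀ b, fderiv ℝ (fun x => ∑ a, u a x * W a b x) x (stdVec b) =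
        ∑ a, (pd b (u a) x * W a b x + u a x * pd b (W a b) x) := by
      intro b
      change pd b _ x = _
      rw [pd_sum (u := fun a y => u a y * W a b y) fun a _ => (hud a).mul (hWd a b)]
      exact Finset.sum_congr rfl fun a _ => pd_mul (hud a) (hWd a b)
    simp only [h1, Finset.sum_add_distrib]
    have h2 : ∑ b, ∑ a, u a x * pd b (W a b) x = 0 := by
      rw [Finset.sum_comm]
      simp only [← Finset.mul_sum, hWp x hx, mul_zero, Finset.sum_const_zero]
    have h3 : ∑ b, ∑ a, pd b (u a) x * W a b x = -∑ b, ∑ a, pd a (u b) x * W a b x := by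
      conv_lhs => rw [Finset.sum_comm]
      simp only [← Finset.sum_neg_distrib]
      refine Finset.sum_congr rfl fun a _ => Finset.sum_congr rfl fun b _ => ?_
      rw [hWs a b]
      ring
    have h4 : ∑ b, ∑ a, W a b x ^ 2 =
        ∑ b, ∑ a, pd a (u b) x * W a b x - ∑ b, ∑ a, pd b (u a) x * W a b x := by
      simp only [← Finset.sum_sub_distrib]
      refine Finset.sum_congr rfl fun b _ => Finset.sum_congr rfl fun a _ => ?_
      rw [sq]
      nth_rw 1 [hWe x hx a b]
      ring
    rw [h2]
    linarith
  rw [setIntegral_congr_fun isOpen_ball4.measurableSet hdiv, integral_const_mul] at hint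
  have hzero : ∫ x in ball4, ∑ b, ∑ a, W a b x ^ 2 = 0 := by linarith
  have hcont : ContinuousOn (fun x => ∑ b, ∑ a, W a b x ^ 2) closedBall4 :=
    continuousOn_finsetSum _ fun b _ => continuousOn_finsetSum _ fun a _ =>
      (hWc a b).continuousOn.pow 2
  have hi : IntegrableOn (fun x => ∑ b, ∑ a, W a b x ^ 2) ball4 :=
    (hcont.integrableOn_compact isCompact_closedBall4).mono_set ball4_subset_closedBall4
  rw [integral_eq_zero_iff_of_nonneg (fun x => by positivity) hi] at hzero
  filter_upwards [hzero, ae_restrict_mem isOpen_ball4.measurableSet] with x hx hxb a b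
  rw [← hWe x hxb]
  have h1 : ∑ b, ∑ a, W a b x ^ 2 = 0 := hx
  rw [Finset.sum_eq_zero_iff_of_nonneg (fun b _ => by positivity)] at h1
  have h2 := h1 b (Finset.mem_univ _)
  rw [Finset.sum_eq_zero_iff_of_nonneg (fun b _ => by positivity)] at h2
  exact pow_eq_zero_iff two_ne_zero |>.1 (h2 a (Finset.mem_univ _))

theorem contDiffOn_component {A : OneForm} {s : Set R4} {n : WithTop ℕ∞} (hA : ContDiffOn ℝ n A s)
    (l : Fin 3) (a : Fin 4) : ContDiffOn ℝ n (component A l a) s :=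
  (componentCLM l a).contDiff.comp_contDiffOn hA

theorem pd_apply_eq {φ : R4 → LieAlg} (hφ : ContDiff ℝ ∞ φ) (l : Fin 3) (a : Fin 4) (x : R4) :
    pd a (fun y => φ y l) x = fderiv ℝ φ x (stdVec a) l := by
  have := (EuclideanSpace.proj l : LieAlg →L[ℝ] ℝ).hasFDerivAt.comp x
    (hφ.differentiable (by simp) x).hasFDerivAt
  have h3 : (fun y => φ y l) = (EuclideanSpace.proj l : LieAlg →L[ℝ] ℝ) ∘ φ := rfl
  rw [pd, h3, this.fderiv]
  rfl

theorem IsLinearSolution.differentiableAt {A₀ : BoundaryConnection} {A : OneForm}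
    (h : IsLinearSolution A₀ A) {x : R4} (hx : x ∈ ball4) : DifferentiableAt ℝ A x :=
  (h.1.contDiffAt (closedBall4_mem_nhds hx)).differentiableAt (by simp)

/-- Two solutions of the linear Dirichlet problem have the same exterior derivative. -/
theorem IsLinearSolution.ae_extDCoeff_eq {A₀ : BoundaryConnection} {A B : OneForm}
    (hA : IsLinearSolution A₀ A) (hB : IsLinearSolution A₀ B) (l : Fin 3) :
    ∀ᵐ x ∂(volume.restrict ball4), extDCoeff A l x = extDCoeff B l x := by
  obtain ⟨hA1, hA2, φ, hφ, hA3⟩ := id hA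
  obtain ⟨hB1, hB2, χ, hχ, hB3⟩ := id hB
  -- The difference of the gauge functions is smooth on all of ℝ⁴, so dψ can be subtracted from A -
  -- B on the whole ball. This removes the tangential boundary values without changing the curl.
  set ψ : R4 → ℝ := fun x => φ x l - χ x l with hψ
  have hψs : ContDiff ℝ ∞ ψ := by
    have h : ∀ f : R4 → LieAlg, ContDiff ℝ ∞ f → ContDiff ℝ ∞ fun y => f y l := fun f hf =>
      (EuclideanSpace.proj l : LieAlg →L[ℝ] ℝ).contDiff.comp hf
    exact (h φ hφ).sub (h χ hχ)
  have hpψ : ∀ a x, pd a ψ x = fderiv ℝ φ x (stdVec a) l - fderiv ℝ χ x (stdVec a) l := by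
    intro a x
    have h : ∀ f : R4 → LieAlg, ContDiff ℝ ∞ f → Differentiable ℝ fun y => f y l := fun f hf =>
      ((EuclideanSpace.proj l : LieAlg →L[ℝ] ℝ).contDiff.comp hf).differentiable (by simp)
    rw [hψ, pd_sub (h φ hφ x) (h χ hχ x), pd_apply_eq hφ, pd_apply_eq hχ]
  set u : Fin 4 → R4 → ℝ := fun a x => component A l a x - component B l a x - pd a ψ x with hu
  have hpdψ : ∀ a x, ContDiffAt ℝ ∞ (pd a ψ) x := fun a x =>
    contDiffAt_pd hψs.contDiffAt (by simp)
  have hu2 : ∀ a, ContDiffOn ℝ 2 (u a) closedBall4 := fun a =>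
    (((contDiffOn_component hA1 l a).sub (contDiffOn_component hB1 l a)).sub
      (fun x _ => (hpdψ a x).contDiffWithinAt)).of_le (infty_ge 2)
  have hcurl : ∀ x ∈ ball4, ∀ a b, pd a (u b) x - pd b (u a) x =
      extDCoeff A l x a b - extDCoeff B l x a b := by
    intro x hx a b
    have hcA : ∀ c, DifferentiableAt ℝ (component A l c) x := fun c =>
      ((contDiffOn_component hA1 l c).contDiffAt (closedBall4_mem_nhds hx)).differentiableAt
        (by simp)
    have hcB : ∀ c, DifferentiableAt ℝ (component B l c) x := fun c =>
      ((contDiffOn_component hB1 l c).contDiffAt (closedBall4_mem_nhds hx)).differentiableAt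
        (by simp)
    have hp : ∀ c, DifferentiableAt ℝ (pd c ψ) x := fun c =>
      (hpdψ c x).differentiableAt (by simp)
    have e : ∀ c d, pd c (u d) x =
        pd c (component A l d) x - pd c (component B l d) x - pd c (pd d ψ) x := by
      intro c d
      rw [← pd_sub (hcA d) (hcB d)]
      exact pd_sub ((hcA d).sub (hcB d)) (hp d)
    rw [e, e, extDCoeff_eq (hA.differentiableAt hx), extDCoeff_eq (hB.differentiableAt hx),
      pd_comm (a := a) (b := b) (hψs.contDiffAt.of_le (infty_ge 2))]
    ring
  have hext : ∀ (C : OneForm), ContDiffOn ℝ ∞ C closedBall4 → ∀ x ∈ ball4, ∀ a b,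
      DifferentiableAt ℝ (fun y => extDCoeff C l y a b) x := by
    intro C hC x hx a b
    have hcd : ∀ c d, DifferentiableAt ℝ (pd d (component C l c)) x := fun c d =>
      (contDiffAt_pd (m := 1) (((contDiffOn_component hC l c).contDiffAt
        (closedBall4_mem_nhds hx)).of_le (infty_ge 2)) (by norm_num)).differentiableAt one_ne_zero
    refine ((hcd b a).sub (hcd a b)).congr_of_eventuallyEq ?_
    filter_upwards [isOpen_ball4.mem_nhds hx] with y hy
    exact extDCoeff_eq ((hC.contDiffAt (closedBall4_mem_nhds hy)).differentiableAt (by simp)) l a b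
  have key := ae_closed_of_coclosed hu2 (fun x hx => by
    -- The multiplier is the normal component ∑ u_a x_a, written out.
    refine ⟨component A l 0 x * x 0 + component A l 1 x * x 1 + component A l 2 x * x 2 +
      component A l 3 x * x 3 - (component B l 0 x * x 0 + component B l 1 x * x 1 +
        component B l 2 x * x 2 + component B l 3 x * x 3) -
      (pd 0 ψ x * x 0 + pd 1 ψ x * x 1 + pd 2 ψ x * x 2 + pd 3 ψ x * x 3), fun a => ?_⟩
    set T : R4 →L[ℝ] LieAlg := A x - B x - (fderiv ℝ φ x - fderiv ℝ χ x) with hT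
    have hTu : ∀ a, T (stdVec a) l = u a x := by
      intro a
      simp [hT, hu, component, hpψ]
    have hT0 : ∀ v : R4, inner ℝ x v = 0 → T v = 0 := by
      intro v hv
      have h1 := hA3 ⟨x, by simpa using hx⟩ v hv
      have h2 := hB3 ⟨x, by simpa using hx⟩ v hv
      simp only at h1 h2
      simp [hT, h1, h2]
    have hv : inner ℝ x (stdVec a - x a • x) = 0 := by
      rw [inner_sub_right, inner_smul_right, inner_stdVec, real_inner_self_eq_norm_sq, hx]
      ring
    have h3 := hT0 _ hv
    have h5 : T (stdVec a) = x a • T x := by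
      rw [map_sub, map_smul, sub_eq_zero] at h3
      exact h3
    have h6 : T x l = ∑ b, x b * T (stdVec b) l := by
      conv_lhs => rw [← sum_smul_stdVec x, map_sum]
      simp
    rw [← hTu, h5, PiLp.smul_apply, h6]
    simp only [hTu, hu, Fin.sum_univ_four, smul_eq_mul]
    ring) (fun x hx b => by
    have h1 : ∀ a, pd a (fun y => pd a (u b) y - pd b (u a) y) x =
        fderiv ℝ (fun y => extDCoeff A l y a b) x (stdVec a) -
          fderiv ℝ (fun y => extDCoeff B l y a b) x (stdVec a) := by
      intro a
      have : (fun y => pd a (u b) y - pd b (u a) y) =ᶠ[𝓝 x]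
          fun y => extDCoeff A l y a b - extDCoeff B l y a b := by
        filter_upwards [isOpen_ball4.mem_nhds hx] with y hy using hcurl y hy a b
      rw [pd_congr this, pd_sub (hext A hA1 x hx a b) (hext B hB1 x hx a b)]
      rfl
    simp only [h1, Finset.sum_sub_distrib, hA2 x hx l b, hB2 x hx l b, sub_zero])
  filter_upwards [key, ae_restrict_mem isOpen_ball4.measurableSet] with x hx hxb
  funext a b
  have := hx a b
  rw [hcurl x hxb, sub_eq_zero] at this
  exact this

/-! ### Polynomial solutions of the Dirichlet problems -/

/-- Real polynomials in four variables. -/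
abbrev Poly4 : Type := MvPolynomial (Fin 4) ℝ

/-- The function on `ℝ⁴` defined by a polynomial. -/
def evalFn (P : Poly4) (x : R4) : ℝ := MvPolynomial.eval (fun a => x a) P

theorem evalFn_def (P : Poly4) : evalFn P = fun x => MvPolynomial.eval (fun a => x a) P := rfl

@[simp] theorem evalFn_C (c : ℝ) (x : R4) : evalFn (MvPolynomial.C c) x = c := by simp [evalFn]
@[simp] theorem evalFn_X (a : Fin 4) (x : R4) : evalFn (MvPolynomial.X a) x = x a := by
  simp [evalFn]
@[simp] theorem evalFn_one (x : R4) : evalFn 1 x = 1 := by simp [evalFn]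
@[simp] theorem evalFn_zero (x : R4) : evalFn 0 x = 0 := by simp [evalFn]
@[simp] theorem evalFn_add (P Q : Poly4) (x : R4) :
    evalFn (P + Q) x = evalFn P x + evalFn Q x := by simp [evalFn]
@[simp] theorem evalFn_sub (P Q : Poly4) (x : R4) :
    evalFn (P - Q) x = evalFn P x - evalFn Q x := by simp [evalFn]
@[simp] theorem evalFn_mul (P Q : Poly4) (x : R4) :
    evalFn (P * Q) x = evalFn P x * evalFn Q x := by simp [evalFn]
@[simp] theorem evalFn_pow (P : Poly4) (n : ℕ) (x : R4) :
    evalFn (P ^ n) x = evalFn P x ^ n := by simp [evalFn]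
@[simp] theorem evalFn_smul (c : ℝ) (P : Poly4) (x : R4) :
    evalFn (c • P) x = c * evalFn P x := by simp [evalFn]
@[simp] theorem evalFn_sum {ι : Type*} (s : Finset ι) (P : ι → Poly4) (x : R4) :
    evalFn (∑ i ∈ s, P i) x = ∑ i ∈ s, evalFn (P i) x := by simp [evalFn]

theorem contDiff_evalFn (P : Poly4) : ContDiff ℝ ∞ (evalFn P) := by
  induction P using MvPolynomial.induction_on with
  | C c => simpa [evalFn_def] using contDiff_const
  | add P Q hP hQ => simpa [evalFn_def] using hP.add hQ
  | mul_X P a hP =>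
    have h : ContDiff ℝ ∞ (fun x : R4 => x a) := by fun_prop
    simpa [evalFn_def] using hP.mul h

theorem differentiable_evalFn (P : Poly4) : Differentiable ℝ (evalFn P) :=
  (contDiff_evalFn P).differentiable (by simp)

theorem pd_evalFn (a : Fin 4) (P : Poly4) :
    pd a (evalFn P) = evalFn (MvPolynomial.pderiv a P) := by
  ext x
  induction P using MvPolynomial.induction_on with
  | C c =>
    have : evalFn (MvPolynomial.C c) = fun _ => c := by ext; simp
    rw [this, pd_const, MvPolynomial.pderiv_C, evalFn_zero]
  | add P Q hP hQ =>
    have : evalFn (P + Q) = fun x => evalFn P x + evalFn Q x := by ext; simp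
    rw [this, pd_add (differentiable_evalFn P x) (differentiable_evalFn Q x), hP, hQ]
    simp
  | mul_X P b hP =>
    have : evalFn (P * MvPolynomial.X b) = fun x => evalFn P x * x b := by ext; simp
    rw [this, pd_mul (differentiable_evalFn P x) (by fun_prop), hP, pd_coord]
    by_cases h : b = a
    · subst h
      simp
      ring
    · simp [h, MvPolynomial.pderiv_X_of_ne h]
      ring

theorem eq_zero_of_evalFn {P : Poly4} (h : ∀ x ∈ ball4, evalFn P x = 0) : P = 0 := by
  -- A polynomial vanishing on a product of infinite sets is zero; the cube of side 1/4 lies in the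
  -- ball because 4 · (1/16) < 1.
  refine MvPolynomial.funext_set (fun _ => Ioo (0 : ℝ) (1 / 4)) (fun _ => Ioo_infinite (by norm_num))
    fun x hx => ?_
  rw [map_zero]
  refine h (WithLp.toLp 2 x) ?_
  rw [mem_ball4]
  have h1 : ‖(WithLp.toLp 2 x : R4)‖ ^ 2 < 1 := by
    rw [norm_sq_eq_sum]
    have h2 : ∀ a, x a ^ 2 ≤ 1 / 16 := by
      intro a
      have := hx a (mem_univ _)
      simp only [mem_Ioo] at this
      nlinarith
    calc ∑ a, x a ^ 2 ≤ ∑ _a : Fin 4, (1 / 16 : ℝ) := Finset.sum_le_sum fun a _ => h2 a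
      _ < 1 := by norm_num
  exact (sq_lt_one_iff₀ (norm_nonneg _)).1 h1

/-- The Laplace operator on polynomials. -/
def polyLap : Poly4 →ₗ[ℝ] Poly4 :=
  ∑ a, (MvPolynomial.pderiv a).toLinearMap ∘ₗ (MvPolynomial.pderiv a).toLinearMap

theorem polyLap_apply (P : Poly4) :
    polyLap P = ∑ a, MvPolynomial.pderiv a (MvPolynomial.pderiv a P) := by
  simp [polyLap]

theorem sum_pd_pd_evalFn (P : Poly4) (x : R4) :
    ∑ a, pd a (pd a (evalFn P)) x = evalFn (polyLap P) x := by
  simp [polyLap_apply, pd_evalFn]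

/-- The polynomial `1 - |x|²`. -/
def defPoly : Poly4 := 1 - ∑ a, MvPolynomial.X a ^ 2

theorem evalFn_defPoly (x : R4) : evalFn defPoly x = 1 - ‖x‖ ^ 2 := by
  simp [defPoly, norm_sq_eq_sum]

theorem defPoly_ne_zero : defPoly ≠ 0 := by
  intro h
  have := evalFn_defPoly 0
  simp [h] at this

theorem totalDegree_defPoly : defPoly.totalDegree ≤ 2 := by
  refine (MvPolynomial.totalDegree_sub _ _).trans (max_le (by simp) ?_)
  refine MvPolynomial.totalDegree_finsetSum_le fun a _ => ?_
  simp

theorem totalDegree_pderiv_le {P : Poly4} {n : ℕ} (h : P.totalDegree ≤ n + 1) (a : Fin 4) :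
    (MvPolynomial.pderiv a P).totalDegree ≤ n := by
  refine Finset.sup_le fun m hm => ?_
  rw [MvPolynomial.mem_support_iff, MvPolynomial.coeff_pderiv] at hm
  have h1 : m + Finsupp.single a 1 ∈ P.support := by
    rw [MvPolynomial.mem_support_iff]
    exact left_ne_zero_of_mul hm
  have h2 := (MvPolynomial.le_totalDegree h1).trans h
  rw [Finsupp.sum_add_index' (by simp) (by simp), Finsupp.sum_single_index rfl] at h2
  omega

/-- The product is harmonic and vanishes on the sphere, hence vanishes by the maximum principle. -/
theorem eq_zero_of_polyLap_defPoly_mul {q : Poly4} (h : polyLap (defPoly * q) = 0) : q = 0 := by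
  have h1 : defPoly * q = 0 := by
    refine eq_zero_of_evalFn fun x hx => ?_
    refine eq_zero_of_harmonic (fun x _ => (contDiff_evalFn _).contDiffAt.of_le (infty_ge 2))
      (fun x _ => by rw [sum_pd_pd_evalFn, h, evalFn_zero])
      (contDiff_evalFn _).continuous.continuousOn (fun x hx => ?_) (ball4_subset_closedBall4 hx)
    rw [evalFn_mul, evalFn_defPoly, hx]
    ring
  exact (mul_eq_zero.1 h1).resolve_left defPoly_ne_zero

/-- Every polynomial agrees on the unit sphere with a harmonic polynomial. -/
theorem exists_harmonic_poly (P : Poly4) :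
    ∃ H : Poly4, polyLap H = 0 ∧ ∀ x : R4, ‖x‖ = 1 → evalFn H x = evalFn P x := by
  set n := P.totalDegree with hn
  let W := MvPolynomial.restrictTotalDegree (Fin 4) ℝ n
  have hlap : ∀ Q : Poly4, Q.totalDegree ≤ n + 2 → polyLap Q ∈ W := by
    intro Q hQ
    rw [MvPolynomial.mem_restrictTotalDegree, polyLap_apply]
    exact MvPolynomial.totalDegree_finsetSum_le fun a _ =>
      totalDegree_pderiv_le (totalDegree_pderiv_le hQ a) a
  -- The map q ↦ Δ((1 - |x|²)q) preserves the bound n on the degree. Being injective on a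
  -- finite-dimensional space it is onto, and a preimage q of ΔP gives the harmonic polynomial P -
  -- (1 - |x|²)q.
  let T : W →ₗ[ℝ] W :=
    LinearMap.restrict (polyLap ∘ₗ LinearMap.mulLeft ℝ defPoly) fun q hq => by
      apply hlap
      rw [MvPolynomial.mem_restrictTotalDegree] at hq
      refine (MvPolynomial.totalDegree_mul _ _).trans ?_
      have := totalDegree_defPoly
      omega
  have hT : Function.Injective T := by
    rw [← LinearMap.ker_eq_bot, LinearMap.ker_eq_bot']
    intro q hq
    apply Subtype.ext
    apply eq_zero_of_polyLap_defPoly_mul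
    have := congrArg Subtype.val hq
    simpa [T] using this
  obtain ⟨q, hq⟩ := (LinearMap.injective_iff_surjective.1 hT) ⟨polyLap P, hlap P (by omega)⟩
  have hq' : polyLap (defPoly * (q : Poly4)) = polyLap P := by
    have := congrArg Subtype.val hq
    simpa [T] using this
  refine ⟨P - defPoly * q, by rw [map_sub, hq', sub_self], fun x hx => ?_⟩
  rw [evalFn_sub, evalFn_mul, evalFn_defPoly, hx]
  ring

/-- The inverse of `E + k` on polynomials, where `E = ∑ x_a ∂_a` is the Euler operator. -/
def eulerInv (k : ℕ) : Poly4 →ₗ[ℝ] Poly4 :=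
  (MvPolynomial.basisMonomials (Fin 4) ℝ).constr ℝ
    fun s => MvPolynomial.monomial s ((s.degree : ℝ) + k)⁻¹

theorem eulerInv_monomial (k : ℕ) (s : Fin 4 →₀ ℕ) (c : ℝ) :
    eulerInv k (MvPolynomial.monomial s c) =
      MvPolynomial.monomial s (c * ((s.degree : ℝ) + k)⁻¹) := by
  have h : MvPolynomial.monomial s c = c • MvPolynomial.basisMonomials (Fin 4) ℝ s := by
    simp [MvPolynomial.smul_monomial]
  rw [h, map_smul, eulerInv, Module.Basis.constr_basis, MvPolynomial.smul_monomial, smul_eq_mul]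

/-- A derivative lowers the degree by one, so the shift must grow by one for degree plus shift to
stay the same. -/
theorem pderiv_eulerInv (k : ℕ) (a : Fin 4) (P : Poly4) :
    MvPolynomial.pderiv a (eulerInv k P) = eulerInv (k + 1) (MvPolynomial.pderiv a P) := by
  induction P using MvPolynomial.induction_on' with
  | add P Q hP hQ => simp only [map_add, hP, hQ]
  | monomial s c =>
    rw [eulerInv_monomial, MvPolynomial.pderiv_monomial, MvPolynomial.pderiv_monomial,
      eulerInv_monomial]
    by_cases h : s a = 0
    · simp [h]
    · have hd : s.degree = (s - Finsupp.single a 1).degree + 1 := by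
        have h1 : s = s - Finsupp.single a 1 + Finsupp.single a 1 := by
          rw [Finsupp.sub_add_single_one_cancel h]
        conv_lhs => rw [h1]
        rw [map_add, Finsupp.degree_single]
      rw [hd]
      push_cast
      congr 1
      ring

theorem euler_eulerInv {k : ℕ} (hk : 0 < k) (P : Poly4) :
    ∑ a, MvPolynomial.X a * MvPolynomial.pderiv a (eulerInv k P) + (k : ℝ) • eulerInv k P = P := by
  induction P using MvPolynomial.induction_on' with
  | add P Q hP hQ =>
    conv_rhs => rw [← hP, ← hQ]
    simp only [map_add, mul_add, Finset.sum_add_distrib, smul_add]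
    abel
  | monomial s c =>
    rw [eulerInv_monomial]
    simp only [MvPolynomial.X_mul_pderiv_monomial, ← Finset.sum_smul]
    rw [← Finsupp.degree_eq_sum, ← Nat.cast_smul_eq_nsmul ℝ, ← add_smul,
      MvPolynomial.smul_monomial, smul_eq_mul]
    congr 1
    have : ((s.degree : ℝ) + k) ≠ 0 := by positivity
    field_simp

theorem polyLap_eulerInv {P : Poly4} (hP : polyLap P = 0) (k : ℕ) :
    polyLap (eulerInv k P) = 0 := by
  have : polyLap (eulerInv k P) = eulerInv (k + 2) (polyLap P) := by
    simp only [polyLap_apply, pderiv_eulerInv, map_sum]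
  rw [this, hP, map_zero]

/-- Every polynomial 1-form agrees on the unit sphere, up to its normal part, with a polynomial
solution of `d*dA = 0`. -/
theorem exists_coclosed_poly (P : Fin 4 → Poly4) :
    ∃ Q : Fin 4 → Poly4,
      (∀ b, ∑ a, MvPolynomial.pderiv a
        (MvPolynomial.pderiv a (Q b) - MvPolynomial.pderiv b (Q a)) = 0) ∧
      ∀ x : R4, ‖x‖ = 1 → ∃ c, ∀ b, evalFn (Q b) x = evalFn (P b) x + c * x b := by
  choose H hH1 hH2 using fun b => exists_harmonic_poly (P b)
  -- With H harmonic and Q_b = H_b - f x_b, the equation is ΔQ_b = ∂_b div Q. If f is harmonic, then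
  -- ΔQ_b = -2∂_b f and div Q = g - Ef - 4f, with E the Euler operator. The choice (E + 2)f = g
  -- makes div Q = -2f, and f is harmonic because g is.
  set g : Poly4 := ∑ a, MvPolynomial.pderiv a (H a) with hg
  set f : Poly4 := eulerInv 2 g with hf
  have hcomm : ∀ (a b : Fin 4) (R : Poly4), MvPolynomial.pderiv a (MvPolynomial.pderiv b R) =
      MvPolynomial.pderiv b (MvPolynomial.pderiv a R) := by
    intro a b R
    have h : ∀ x ∈ ball4, evalFn (MvPolynomial.pderiv a (MvPolynomial.pderiv b R) -
        MvPolynomial.pderiv b (MvPolynomial.pderiv a R)) x = 0 := by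
      intro x _
      rw [evalFn_sub, ← pd_evalFn, ← pd_evalFn, ← pd_evalFn, ← pd_evalFn,
        pd_comm ((contDiff_evalFn R).contDiffAt.of_le (infty_ge 2)), sub_self]
    exact sub_eq_zero.1 (eq_zero_of_evalFn h)
  have hgl : polyLap g = 0 := by
    have h : ∀ a c, MvPolynomial.pderiv c (MvPolynomial.pderiv c (MvPolynomial.pderiv a (H a))) =
        MvPolynomial.pderiv a (MvPolynomial.pderiv c (MvPolynomial.pderiv c (H a))) := by
      intro a c
      rw [hcomm c a (H a), hcomm c a]
    simp only [polyLap_apply, hg, map_sum, h]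
    refine Finset.sum_eq_zero fun a _ => ?_
    rw [← map_sum, ← polyLap_apply, hH1, map_zero]
  have hfl : polyLap f = 0 := polyLap_eulerInv hgl 2
  have hfe : ∑ a, MvPolynomial.X a * MvPolynomial.pderiv a f + (2 : ℝ) • f = g := by
    have := euler_eulerInv two_pos g
    exact_mod_cast this
  refine ⟨fun b => H b - f * MvPolynomial.X b, fun b => ?_, fun x hx => ⟨-evalFn f x, fun b => ?_⟩⟩
  · have h1 : ∑ a, MvPolynomial.pderiv a (H a - f * MvPolynomial.X a) = -(2 : ℝ) • f := by
      have h2 : ∀ a, MvPolynomial.pderiv a (H a - f * MvPolynomial.X a) =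
          MvPolynomial.pderiv a (H a) - MvPolynomial.X a * MvPolynomial.pderiv a f - f := by
        intro a
        rw [map_sub, MvPolynomial.pderiv_mul, MvPolynomial.pderiv_X_self]
        ring
      simp only [h2, Finset.sum_sub_distrib, ← hg]
      rw [← hfe]
      simp only [Finset.sum_const, Finset.card_univ, Fintype.card_fin, MvPolynomial.smul_eq_C_mul,
        nsmul_eq_mul, map_neg]
      have : (MvPolynomial.C (2 : ℝ) : Poly4) = 2 := rfl
      rw [this]
      push_cast
      ring
    have h3 : polyLap (H b - f * MvPolynomial.X b) = -(2 : ℝ) • MvPolynomial.pderiv b f := by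
      have h4 : polyLap (f * MvPolynomial.X b) = (2 : ℝ) • MvPolynomial.pderiv b f := by
        have h5 : ∀ a, MvPolynomial.pderiv a (MvPolynomial.pderiv a (f * MvPolynomial.X b)) =
            MvPolynomial.pderiv a (MvPolynomial.pderiv a f) * MvPolynomial.X b +
              (if b = a then 2 * MvPolynomial.pderiv b f else 0) := by
          intro a
          by_cases h : b = a
          · subst h
            simp only [MvPolynomial.pderiv_mul, map_add, MvPolynomial.pderiv_X_self,
              MvPolynomial.pderiv_one, if_true]
            ring
          · simp [MvPolynomial.pderiv_X_of_ne h, h]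
            ring
        rw [polyLap_apply]
        simp only [h5, Finset.sum_add_distrib, ← Finset.sum_mul, ← polyLap_apply, hfl]
        simp only [zero_mul, Finset.sum_ite_eq, Finset.mem_univ, if_true, zero_add, two_mul, two_smul]
      rw [map_sub, hH1, h4, zero_sub, neg_smul]
    have h6 : ∀ R : Fin 4 → Poly4, ∑ a, MvPolynomial.pderiv a (MvPolynomial.pderiv b (R a)) =
        MvPolynomial.pderiv b (∑ a, MvPolynomial.pderiv a (R a)) := by
      intro R
      rw [map_sum]
      exact Finset.sum_congr rfl fun a _ => hcomm a b _
    have h7 : ∀ R : Fin 4 → Poly4, ∑ a, MvPolynomial.pderiv a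
        (MvPolynomial.pderiv a (R b) - MvPolynomial.pderiv b (R a)) =
          polyLap (R b) - MvPolynomial.pderiv b (∑ a, MvPolynomial.pderiv a (R a)) := by
      intro R
      rw [← h6, polyLap_apply, ← Finset.sum_sub_distrib]
      exact Finset.sum_congr rfl fun a _ => map_sub _ _ _
    rw [h7 fun b => H b - f * MvPolynomial.X b, h3, h1, Derivation.map_smul, sub_self]
  · rw [evalFn_sub, evalFn_mul, evalFn_X, hH2 b x hx]
    ring

/-- The linear map `v ↦ v_b e_l`. -/
def basisForm (l : Fin 3) (b : Fin 4) : R4 →L[ℝ] LieAlg :=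
  (EuclideanSpace.proj b : R4 →L[ℝ] ℝ).smulRight (EuclideanSpace.single l 1)

/-- The Lie algebra valued 1-form with polynomial coefficients. -/
def polyForm (P : Fin 3 → Fin 4 → Poly4) : OneForm :=
  fun x => ∑ l, ∑ b, evalFn (P l b) x • basisForm l b

theorem contDiff_polyForm (P : Fin 3 → Fin 4 → Poly4) : ContDiff ℝ ∞ (polyForm P) :=
  ContDiff.sum fun _ _ => ContDiff.sum fun _ _ => (contDiff_evalFn _).smul contDiff_const

theorem polyForm_apply (P : Fin 3 → Fin 4 → Poly4) (x v : R4) (l : Fin 3) :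
    polyForm P x v l = ∑ b, evalFn (P l b) x * v b := by
  simp only [polyForm, sum_apply, smul_apply, basisForm, ContinuousLinearMap.smulRight_apply,
    WithLp.ofLp_sum, Finset.sum_apply, PiLp.smul_apply, smul_eq_mul]
  rw [Finset.sum_eq_single l]
  · simp
  · intro m _ hm
    simp [hm.symm]
  · simp

theorem component_polyForm (P : Fin 3 → Fin 4 → Poly4) (l : Fin 3) (b : Fin 4) :
    component (polyForm P) l b = evalFn (P l b) := by
  ext x
  simp [component, polyForm_apply]

theorem extDCoeff_polyForm (P : Fin 3 → Fin 4 → Poly4) (l : Fin 3) (x : R4) (a b : Fin 4) :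
    extDCoeff (polyForm P) l x a b =
      evalFn (MvPolynomial.pderiv a (P l b) - MvPolynomial.pderiv b (P l a)) x := by
  rw [extDCoeff_eq ((contDiff_polyForm P).differentiable (by simp) x), component_polyForm,
    component_polyForm, pd_evalFn, pd_evalFn, evalFn_sub]

/-- The coclosed equation `d*dA = 0` for a form with polynomial coefficients. -/
def IsCoclosedPoly (Q : Fin 3 → Fin 4 → Poly4) : Prop :=
  ∀ l b, ∑ a, MvPolynomial.pderiv a
    (MvPolynomial.pderiv a (Q l b) - MvPolynomial.pderiv b (Q l a)) = 0

theorem isLinearSolution_polyForm {Q : Fin 3 → Fin 4 → Poly4} (hQ : IsCoclosedPoly Q)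
    {A₀ : BoundaryConnection}
    (hA : ∀ x : S3, ∀ v : R4, inner ℝ (x : R4) v = 0 → A₀.form x v = polyForm Q x v) :
    IsLinearSolution A₀ (polyForm Q) := by
  refine ⟨(contDiff_polyForm Q).contDiffOn, fun x _ l b => ?_, fun _ => 0, contDiff_const,
    fun x v hv => ?_⟩
  · have h : ∀ a, fderiv ℝ (fun y => extDCoeff (polyForm Q) l y a b) x (stdVec a) =
        evalFn (MvPolynomial.pderiv a
          (MvPolynomial.pderiv a (Q l b) - MvPolynomial.pderiv b (Q l a))) x := by
      intro a
      have : (fun y => extDCoeff (polyForm Q) l y a b) =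
          evalFn (MvPolynomial.pderiv a (Q l b) - MvPolynomial.pderiv b (Q l a)) :=
        funext fun y => extDCoeff_polyForm Q l y a b
      rw [this, ← pd_evalFn]
      rfl
    simp only [h, ← evalFn_sum, hQ l b, evalFn_zero]
  · rw [hA x v hv]
    simp

/-- For polynomial boundary values the linear Dirichlet problem has a polynomial solution. -/
theorem exists_isCoclosedPoly (P : Fin 3 → Fin 4 → Poly4) :
    ∃ Q : Fin 3 → Fin 4 → Poly4, IsCoclosedPoly Q ∧
      ∀ x : S3, ∀ v : R4, inner ℝ (x : R4) v = 0 → polyForm P x v = polyForm Q x v := by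
  choose Q hQ1 hQ2 using fun l => exists_coclosed_poly (P l)
  refine ⟨Q, hQ1, fun x v hv => ?_⟩
  ext l
  obtain ⟨c, hc⟩ := hQ2 l x (by simp)
  rw [inner_eq_sum] at hv
  simp only [polyForm_apply, hc, add_mul, Finset.sum_add_distrib, mul_assoc, ← Finset.mul_sum, hv,
    mul_zero, add_zero]

/-! ### Density of polynomial forms by convolution -/

/-- Convolving a compactly supported function with a polynomial yields a polynomial. -/
theorem exists_poly_eq_integral (κ : Poly4) {f : R4 → ℝ} (hf : Continuous f)
    (hs : HasCompactSupport f) : ∃ P : Poly4, ∀ x, ∫ t, evalFn κ (x - t) * f t = evalFn P x := by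
  induction κ using MvPolynomial.induction_on generalizing f with
  | C c => exact ⟨MvPolynomial.C (∫ t, c * f t), fun x => by simp⟩
  | add κ χ hκ hχ =>
    obtain ⟨P, hP⟩ := hκ hf hs
    obtain ⟨Q, hQ⟩ := hχ hf hs
    refine ⟨P + Q, fun x => ?_⟩
    have hi : ∀ κ : Poly4, Integrable fun t => evalFn κ (x - t) * f t := fun κ =>
      (((contDiff_evalFn κ).continuous.comp (by fun_prop)).mul hf).integrable_of_hasCompactSupport
        hs.mul_left
    simp only [evalFn_add, add_mul]
    rw [integral_add (hi κ) (hi χ), hP, hQ]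
  -- The factor x_a - t_a splits, and t_a is absorbed into `f`; hence the induction is over all `f`.
  | mul_X κ a hκ =>
    obtain ⟨P, hP⟩ := hκ hf hs
    obtain ⟨Q, hQ⟩ := hκ (f := fun t => t a * f t) (by fun_prop) hs.mul_left
    refine ⟨P * MvPolynomial.X a - Q, fun x => ?_⟩
    have hi : ∀ f : R4 → ℝ, Continuous f → HasCompactSupport f →
        Integrable fun t => evalFn κ (x - t) * f t := fun f hf hs =>
      (((contDiff_evalFn κ).continuous.comp (by fun_prop)).mul hf).integrable_of_hasCompactSupport
        hs.mul_left
    have h : ∀ t, evalFn (κ * MvPolynomial.X a) (x - t) * f t =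
        x a * (evalFn κ (x - t) * f t) - evalFn κ (x - t) * (t a * f t) := by
      intro t
      rw [evalFn_mul, evalFn_X, PiLp.sub_apply]
      ring
    simp only [h]
    rw [integral_sub ((hi f hf hs).const_mul _) (hi (fun t => t a * f t) (by fun_prop) hs.mul_left), hQ,
      integral_const_mul, hP, evalFn_sub, evalFn_mul, evalFn_X, mul_comm]

/-- The normalized polynomial kernel `c_n (R² - |z|²)ⁿ`. -/
def landauKernel (R : ℝ) (n : ℕ) (z : R4) : ℝ :=
  (∫ y in Metric.closedBall (0 : R4) R, (R ^ 2 - ‖y‖ ^ 2) ^ n)⁻¹ * (R ^ 2 - ‖z‖ ^ 2) ^ n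

theorem landauKernel_eq_evalFn (R : ℝ) (n : ℕ) : ∃ κ : Poly4, landauKernel R n = evalFn κ := by
  refine ⟨MvPolynomial.C (∫ y in Metric.closedBall (0 : R4) R, (R ^ 2 - ‖y‖ ^ 2) ^ n)⁻¹ *
    (MvPolynomial.C (R ^ 2) - ∑ a, MvPolynomial.X a ^ 2) ^ n, ?_⟩
  ext z
  simp [landauKernel, norm_sq_eq_sum]

theorem continuous_landauKernel (R : ℝ) (n : ℕ) : Continuous (landauKernel R n) := by
  obtain ⟨κ, hκ⟩ := landauKernel_eq_evalFn R n
  rw [hκ]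
  exact (contDiff_evalFn κ).continuous

theorem hasCompactSupport_of_eq_zero {W : Type} [NormedAddCommGroup W] {R : ℝ}
    {F : R4 → W} (h : ∀ x, R < ‖x‖ → F x = 0) :
    HasCompactSupport F :=
  HasCompactSupport.intro (isCompact_closedBall (0 : R4) R) fun x hx => h x (by simpa using hx)

section Convolution

variable {W : Type} [NormedAddCommGroup W] [NormedSpace ℝ W]

/-- Convolution with the polynomial kernel. -/
def landauConv (R : ℝ) (n : ℕ) (F : R4 → W) : R4 → W :=
  convolution F (landauKernel R n) (ContinuousLinearMap.lsmul ℝ ℝ).flip volume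

theorem landauConv_apply (R : ℝ) (n : ℕ) (F : R4 → W) (x : R4) :
    landauConv R n F x = ∫ t, landauKernel R n (x - t) • F t := by
  simp [landauConv, convolution_def]

theorem fderiv_eq_zero_of_eq_zero {R : ℝ} {F : R4 → W} (h : ∀ x, R < ‖x‖ → F x = 0) (x : R4)
    (hx : R < ‖x‖) : fderiv ℝ F x = 0 := by
  have : F =ᶠ[𝓝 x] fun _ => 0 := by
    filter_upwards [(isOpen_lt continuous_const continuous_norm).mem_nhds hx] with y hy
    exact h y hy
  rw [this.fderiv_eq]
  simp

/-- The derivative falls on F rather than on the kernel, so approximation of derivatives reduces to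
approximation of functions. -/
theorem hasFDerivAt_landauConv {R₀ R : ℝ} {n : ℕ} {F : R4 → W} (hF : ContDiff ℝ ∞ F)
    (h0 : ∀ x, R₀ < ‖x‖ → F x = 0) (x : R4) :
    HasFDerivAt (landauConv R n F) (landauConv R n (fderiv ℝ F) x) x := by
  have h := (hasCompactSupport_of_eq_zero h0).hasFDerivAt_convolution_left
    (ContinuousLinearMap.lsmul ℝ ℝ : ℝ →L[ℝ] W →L[ℝ] W).flip (hF.of_le (by simp))
    ((continuous_landauKernel R n).locallyIntegrable (μ := volume)) x
  have hL : (ContinuousLinearMap.lsmul ℝ ℝ : ℝ →L[ℝ] (R4 →L[ℝ] W) →L[ℝ] (R4 →L[ℝ] W)).flip =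
      (ContinuousLinearMap.lsmul ℝ ℝ : ℝ →L[ℝ] W →L[ℝ] W).flip.precompL R4 := by
    ext
    rfl
  rw [landauConv, landauConv, hL]
  exact h

theorem eventually_landauConv_sub_lt [CompleteSpace W] {R : ℝ} (hR : 1 ≤ R) {F : R4 → W}
    (hF : Continuous F) (h0 : ∀ x, R - 1 < ‖x‖ → F x = 0) {ε : ℝ} (hε : 0 < ε) :
    ∀ᶠ n in atTop, ∀ x ∈ closedBall4, ‖landauConv R n F x - F x‖ < ε := by
  have : CompactSpace closedBall4 := isCompact_iff_compactSpace.1 isCompact_closedBall4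
  -- The translates of F are viewed as points of C(closed ball, W), so that convergence of the
  -- peaked averages in this space is uniform in x.
  set g : C(R4, C(closedBall4, W)) :=
    ContinuousMap.curry ⟨fun q : R4 × closedBall4 => F ((q.2 : R4) - q.1), by fun_prop⟩ with hg
  set s : Set R4 := Metric.closedBall 0 R with hs
  have hpow : ∀ n : ℕ, Continuous fun z : R4 => (R ^ 2 - ‖z‖ ^ 2) ^ n := fun n => by fun_prop
  have hlim := tendsto_setIntegral_pow_smul_of_unique_maximum_of_isCompact_of_continuousOn
    (μ := (volume : Measure R4)) (s := s) (x₀ := 0) (c := fun z => R ^ 2 - ‖z‖ ^ 2) (g := g)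
    (isCompact_closedBall _ _) (by fun_prop)
    (fun y _ hy => by
      have := norm_pos_iff.2 hy
      simp only [norm_zero]
      nlinarith)
    (fun y hy => by
      have : ‖y‖ ≤ R := by simpa [hs] using hy
      nlinarith [norm_nonneg y])
    (by simp only [norm_zero]; nlinarith)
    (by
      rw [hs, interior_closedBall _ (by linarith : R ≠ 0)]
      apply subset_closure
      simp only [Metric.mem_ball, dist_self]
      linarith)
    g.continuous.continuousOn
  have hev := hlim.eventually (Metric.ball_mem_nhds _ hε)
  filter_upwards [hev] with n hn x hx
  rw [dist_eq_norm] at hn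
  have hval : ((∫ z in s, (R ^ 2 - ‖z‖ ^ 2) ^ n)⁻¹ •
      ∫ z in s, (R ^ 2 - ‖z‖ ^ 2) ^ n • g z) ⟨x, hx⟩ = landauConv R n F x := by
    have hi : IntegrableOn (fun z => (R ^ 2 - ‖z‖ ^ 2) ^ n • g z) s :=
      ((hpow n).smul g.continuous).continuousOn.integrableOn_compact (isCompact_closedBall _ _)
    have h1 : (∫ z in s, (R ^ 2 - ‖z‖ ^ 2) ^ n • g z) ⟨x, hx⟩ =
        ∫ z in s, (R ^ 2 - ‖z‖ ^ 2) ^ n • F (x - z) := by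
      have := ((ContinuousMap.evalCLM ℝ (⟨x, hx⟩ : closedBall4) :
        C(closedBall4, W) →L[ℝ] W).integral_comp_comm hi).symm
      exact this
    rw [ContinuousMap.smul_apply, h1, landauConv_apply,
      ← integral_sub_left_eq_self _ volume x]
    simp only [sub_sub_cancel, landauKernel, ← hs, mul_smul]
    rw [integral_smul]
    congr 1
    -- The kernel is not truncated, but for |x| ≤ 1 and |z| > R the point x - z lies outside the
    -- support of F. This is the reason for the margin R - 1.
    refine setIntegral_eq_integral_of_forall_compl_eq_zero fun z hz => ?_
    rw [h0, smul_zero]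
    have h2 : R < ‖z‖ := by simpa [hs] using hz
    have h3 : ‖x‖ ≤ 1 := mem_closedBall4.1 hx
    have h4 := norm_sub_norm_le z x
    rw [norm_sub_rev] at h4
    linarith
  have hval0 : g 0 ⟨x, hx⟩ = F x := by simp [hg]
  rw [← hval, ← hval0, ← ContinuousMap.sub_apply]
  exact (ContinuousMap.norm_coe_le_norm _ _).trans_lt hn

/-- The induction on the order replaces F by `fderiv ℝ F`, whose values lie in another space;
therefore W is quantified after m. -/
theorem eventually_iteratedFDeriv_landauConv_sub_lt {R : ℝ} (hR : 1 ≤ R) (m : ℕ) {ε : ℝ}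
    (hε : 0 < ε) : ∀ {W : Type} [NormedAddCommGroup W] [NormedSpace ℝ W] [CompleteSpace W]
      {F : R4 → W}, ContDiff ℝ ∞ F → (∀ x, R - 1 < ‖x‖ → F x = 0) →
    ∀ᶠ n in atTop, ∀ x ∈ closedBall4,
      ‖iteratedFDeriv ℝ m (fun x => landauConv R n F x - F x) x‖ < ε := by
  induction m with
  | zero =>
    intro W _ _ _ F hF h0
    simpa using eventually_landauConv_sub_lt hR hF.continuous h0 hε
  | succ m ih =>
    intro W _ _ _ F hF h0
    have hF' : ContDiff ℝ ∞ (fderiv ℝ F) := hF.fderiv_right (by simp)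
    filter_upwards [ih hF' (fderiv_eq_zero_of_eq_zero h0)] with n hn x hx
    have : (fun x => landauConv R n (fderiv ℝ F) x - fderiv ℝ F x) =
        fderiv ℝ (fun x => landauConv R n F x - F x) := by
      funext y
      exact ((hasFDerivAt_landauConv hF h0 y).sub
        (hF.differentiable (by simp) y).hasFDerivAt).fderiv.symm
    rw [← norm_iteratedFDeriv_fderiv, ← this]
    exact hn x hx

end Convolution

theorem exists_polyForm_eq_landauConv {R₀ R : ℝ} {n : ℕ} {F : OneForm} (hF : Continuous F)
    (h0 : ∀ x, R₀ < ‖x‖ → F x = 0) :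
    ∃ P : Fin 3 → Fin 4 → Poly4, polyForm P = landauConv R n F := by
  obtain ⟨κ, hκ⟩ := landauKernel_eq_evalFn R n
  have hc : ∀ l b, Continuous (component F l b) := fun l b => (componentCLM l b).continuous.comp hF
  have hs : ∀ l b, HasCompactSupport (component F l b) := fun l b =>
    hasCompactSupport_of_eq_zero (R := R₀) fun x hx => by simp [component, h0 x hx]
  choose P hP using fun l b => exists_poly_eq_integral κ (hc l b) (hs l b)
  refine ⟨P, funext fun x => form_ext fun l b => ?_⟩
  have hk : Continuous fun t => landauKernel R n (x - t) :=
    (continuous_landauKernel R n).comp (by fun_prop)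
  have hi : Integrable fun t => landauKernel R n (x - t) • F t :=
    Continuous.integrable_of_hasCompactSupport (hk.smul hF)
      (hasCompactSupport_of_eq_zero (R := R₀) fun x hx => by
        rw [h0 x hx]
        exact smul_zero (M := ℝ) (A := R4 →L[ℝ] LieAlg) _)
  have h1 : landauConv R n F x (stdVec b) l = ∫ t, landauKernel R n (x - t) * component F l b t := by
    rw [landauConv_apply, ← componentCLM_apply, ← (componentCLM l b).integral_comp_comm hi]
    simp [component]
  rw [h1, hκ, hP, ← component_polyForm P l b, component]

/-- Polynomial 1-forms are dense in the `C^k` topology. -/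
theorem exists_polyForm_approx {R : ℝ} (hR : 1 ≤ R) {F : OneForm} (hF : ContDiff ℝ ∞ F)
    (h0 : ∀ x, R - 1 < ‖x‖ → F x = 0) (k : ℕ) {ε : ℝ} (hε : 0 < ε) :
    ∃ P : Fin 3 → Fin 4 → Poly4, ∀ m ≤ k, ∀ x ∈ closedBall4,
      ‖iteratedFDeriv ℝ m (fun x => polyForm P x - F x) x‖ < ε := by
  have h : ∀ᶠ n in atTop, ∀ m ∈ Finset.range (k + 1), ∀ x ∈ closedBall4,
      ‖iteratedFDeriv ℝ m (fun x => landauConv R n F x - F x) x‖ < ε := by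
    rw [Filter.eventually_all_finset]
    exact fun m _ => eventually_iteratedFDeriv_landauConv_sub_lt hR m hε hF h0
  obtain ⟨n, hn⟩ := h.exists
  obtain ⟨P, hP⟩ := exists_polyForm_eq_landauConv (R := R) (n := n) hF.continuous h0
  refine ⟨P, fun m hm x hx => ?_⟩
  rw [hP]
  exact hn m (Finset.mem_range.2 (by omega)) x hx

/-! ### Boundary connections: extension, tangential part and C^k bounds -/

/-- The radial extension of a smooth function on the sphere is smooth away from the origin. -/
theorem contDiffAt_radialExt {V : Type*} [NormedAddCommGroup V] [NormedSpace ℝ V] {f : S3 → V}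
    (hf : ContMDiff (𝓡 3) 𝓘(ℝ, V) ∞ f) {x : R4} (hx : x ≠ 0) :
    ContDiffAt ℝ ∞ (radialExt f) x := by
  let U : TopologicalSpace.Opens R4 := ⟨{0}ᶜ, isOpen_compl_singleton⟩
  have hU : ∀ y : U, (y : R4) ≠ 0 := fun y => y.2
  have hmem : ∀ y : U, ‖(y : R4)‖⁻¹ • (y : R4) ∈ Metric.sphere (0 : R4) 1 := fun y => by
    simp [norm_smul, norm_ne_zero_iff.mpr (hU y)]
  -- The radial extension is the composite of `f` with y ↦ y/|y|, a smooth map from the punctured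
  -- space to the sphere.
  have h1 : ContMDiff 𝓘(ℝ, R4) 𝓘(ℝ, R4) ∞ fun y : U => ‖(y : R4)‖⁻¹ • (y : R4) := by
    intro y
    refine (contMDiffAt_subtype_iff (U := U) (f := fun y : R4 => ‖y‖⁻¹ • y)).2 ?_
    rw [contMDiffAt_iff_contDiffAt]
    exact ((contDiffAt_norm ℝ (hU y)).inv (norm_ne_zero_iff.2 (hU y))).smul contDiffAt_id
  have h2 := hf.comp (h1.codRestrict_sphere hmem)
  have h3 : (f ∘ Set.codRestrict _ _ hmem) = fun y : U => radialExt f y := by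
    funext y
    simp [radialExt, hU y, Set.codRestrict]
  rw [h3] at h2
  have h4 := h2 ⟨x, hx⟩
  rw [contMDiffAt_subtype_iff (U := U) (f := radialExt f), contMDiffAt_iff_contDiffAt] at h4
  exact h4

/-- A smooth radial function that vanishes near the origin and is `1` near the unit sphere. -/
def innerCutoff (x : R4) : ℝ := Real.smoothTransition (4 * ‖x‖ ^ 2 - 1)

theorem contDiff_innerCutoff : ContDiff ℝ ∞ innerCutoff := by
  unfold innerCutoff
  exact Real.smoothTransition.contDiff.comp
    ((contDiff_const.mul (contDiff_norm_sq ℝ)).sub contDiff_const)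

theorem innerCutoff_eventuallyEq_zero : innerCutoff =ᶠ[𝓝 0] fun _ => 0 := by
  have ho : IsOpen {y : R4 | 4 * ‖y‖ ^ 2 - 1 < 0} := isOpen_lt (by fun_prop) continuous_const
  filter_upwards [ho.mem_nhds (show 4 * ‖(0 : R4)‖ ^ 2 - 1 < 0 by simp)] with y hy
  exact Real.smoothTransition.zero_of_nonpos (le_of_lt hy)

theorem innerCutoff_eq_one {x : R4} (hx : 1 / 2 ≤ ‖x‖ ^ 2) : innerCutoff x = 1 :=
  Real.smoothTransition.one_of_one_le (by linarith)

/-- A smooth radial function that is `1` near the unit sphere and vanishes for `|x| > 2`. -/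
def outerCutoff (x : R4) : ℝ := Real.smoothTransition (3 - ‖x‖ ^ 2)

theorem contDiff_outerCutoff : ContDiff ℝ ∞ outerCutoff := by
  unfold outerCutoff
  exact Real.smoothTransition.contDiff.comp (contDiff_const.sub (contDiff_norm_sq ℝ))

/-- The map `x ↦ x / |x|`, modified near the origin to be smooth on `ℝ⁴`. -/
def unitExt (x : R4) : R4 := (innerCutoff x * ‖x‖⁻¹) • x

theorem contDiff_unitExt : ContDiff ℝ ∞ unitExt := by
  rw [contDiff_iff_contDiffAt]
  intro x
  by_cases hx : x = 0
  · subst hx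
    have : unitExt =ᶠ[𝓝 0] fun _ => 0 := by
      filter_upwards [innerCutoff_eventuallyEq_zero] with y hy
      rw [unitExt, hy, zero_mul, zero_smul]
    exact contDiffAt_const.congr_of_eventuallyEq this
  · exact (contDiff_innerCutoff.contDiffAt.mul ((contDiffAt_norm ℝ hx).inv
      (norm_ne_zero_iff.2 hx))).smul contDiffAt_id

theorem unitExt_sphere {x : R4} (hx : ‖x‖ = 1) : unitExt x = x := by
  rw [unitExt, innerCutoff_eq_one (by rw [hx]; norm_num), hx]
  simp

/-- This replaces the radial extension, singular at the origin, by a composite with a globally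
smooth map, to which bounds for iterated derivatives apply. -/
theorem radialExt_eventuallyEq {V : Type*} [NormedAddCommGroup V] (H : R4 → V) {x : R4}
    (hx : ‖x‖ = 1) : radialExt (fun y : S3 => H y) =ᶠ[𝓝 x] H ∘ unitExt := by
  have ho : IsOpen {y : R4 | 1 / 2 < ‖y‖ ^ 2} := isOpen_lt continuous_const (by fun_prop)
  filter_upwards [ho.mem_nhds (show 1 / 2 < ‖x‖ ^ 2 by rw [hx]; norm_num)] with y hy
  have hy' : 1 / 2 < ‖y‖ ^ 2 := hy
  have hy0 : y ≠ 0 := by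
    rintro rfl
    norm_num at hy'
  simp [radialExt, hy0, unitExt, innerCutoff_eq_one hy'.le]

/-- Every smooth boundary connection is the restriction of a smooth compactly supported form. -/
theorem BoundaryConnection.exists_extension (A : BoundaryConnection) :
    ∃ F : OneForm, ContDiff ℝ ∞ F ∧ (∀ x, (3 : ℝ) - 1 < ‖x‖ → F x = 0) ∧
      ∀ x : S3, F x = A.form x := by
  refine ⟨fun x => (innerCutoff x * outerCutoff x) • radialExt A.form x, ?_, fun x hx => ?_,
    fun x => ?_⟩
  · rw [contDiff_iff_contDiffAt]
    intro x
    by_cases hx : x = 0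
    · subst hx
      have : (fun x => (innerCutoff x * outerCutoff x) • radialExt A.form x) =ᶠ[𝓝 0]
          fun _ => 0 := by
        filter_upwards [innerCutoff_eventuallyEq_zero] with y hy
        rw [hy, zero_mul]
        exact zero_smul ℝ (radialExt A.form y)
      exact contDiffAt_const.congr_of_eventuallyEq this
    · exact (contDiff_innerCutoff.mul contDiff_outerCutoff).contDiffAt.smul
        (contDiffAt_radialExt A.smooth hx)
  · have : outerCutoff x = 0 := Real.smoothTransition.zero_of_nonpos (by nlinarith)
    simp only [this, mul_zero]
    exact zero_smul ℝ (radialExt A.form x)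
  · have hx : ‖(x : R4)‖ = 1 := by simp
    have hx0 : (x : R4) ≠ 0 := by
      intro h
      simp [h] at hx
    have h1 : outerCutoff x = 1 :=
      Real.smoothTransition.one_of_one_le (by rw [hx]; norm_num)
    simp only [innerCutoff_eq_one (show 1 / 2 ≤ ‖(x : R4)‖ ^ 2 by rw [hx]; norm_num), h1]
    simp [radialExt, hx0]

/-- For a unit vector `z`, the orthogonal projection to the tangent space at `z`. -/
def tangentProj (z : R4) : R4 →L[ℝ] R4 :=
  ContinuousLinearMap.id ℝ R4 - ContinuousLinearMap.smulRightL ℝ R4 R4 (innerSL ℝ z) z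

theorem tangentProj_apply (z v : R4) : tangentProj z v = v - inner ℝ z v • z := by
  simp [tangentProj]

theorem contDiff_tangentProj : ContDiff ℝ ∞ tangentProj := by
  unfold tangentProj
  exact contDiff_const.sub
    (((ContinuousLinearMap.smulRightL ℝ R4 R4).contDiff.comp (innerSL ℝ).contDiff).clm_apply
      contDiff_id)

theorem contDiff_comp_tangentProj {G : OneForm} (hG : ContDiff ℝ ∞ G) :
    ContDiff ℝ ∞ fun z => (G z).comp (tangentProj z) :=
  hG.clm_comp contDiff_tangentProj

/-- The tangential part of a smooth 1-form along the sphere. -/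
def tangential (G : OneForm) (hG : ContDiff ℝ ∞ G) : BoundaryConnection where
  form x := (G x).comp (tangentProj x)
  normal_eq_zero x := by simp [tangentProj_apply]
  smooth := (contDiff_comp_tangentProj hG).contMDiff.comp contMDiff_coe_sphere

theorem tangential_form_apply {G : OneForm} (hG : ContDiff ℝ ∞ G) (x : S3) {v : R4}
    (hv : inner ℝ (x : R4) v = 0) : (tangential G hG).form x v = G x v := by
  simp [tangential, tangentProj_apply, hv]

theorem exists_bound_iteratedFDeriv {V : Type*} [NormedAddCommGroup V] [NormedSpace ℝ V]
    {f : R4 → V} (hf : ContDiff ℝ ∞ f) (k : ℕ) :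
    ∃ C : ℝ, 1 ≤ C ∧ ∀ j ≤ k, ∀ x ∈ closedBall4, ‖iteratedFDeriv ℝ j f x‖ ≤ C := by
  have h : ∀ j : ℕ, ∃ C, ∀ x ∈ closedBall4, ‖iteratedFDeriv ℝ j f x‖ ≤ C := fun j =>
    isCompact_closedBall4.exists_bound_of_continuousOn
      (hf.continuous_iteratedFDeriv (infty_ge j)).continuousOn
  choose C hC using h
  have hnn : ∀ j, 0 ≤ C j := fun j =>
    (norm_nonneg _).trans (hC j 0 (by simp [closedBall4]))
  refine ⟨1 + ∑ j ∈ Finset.range (k + 1), C j, ?_, fun j hj x hx => (hC j x hx).trans ?_⟩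
  · linarith [Finset.sum_nonneg fun j (_ : j ∈ Finset.range (k + 1)) => hnn j]
  · have := Finset.single_le_sum (fun j _ => hnn j)
      (Finset.mem_range.2 (Nat.lt_succ_of_le hj))
    linarith

theorem norm_iteratedFDeriv_clm_comp_le {D E F G : Type*} [NormedAddCommGroup D]
    [NormedSpace ℝ D] [NormedAddCommGroup E] [NormedSpace ℝ E] [NormedAddCommGroup F]
    [NormedSpace ℝ F] [NormedAddCommGroup G] [NormedSpace ℝ G] {f : D → F →L[ℝ] G}
    {g : D → E →L[ℝ] F} (hf : ContDiff ℝ ∞ f) (hg : ContDiff ℝ ∞ g) (x : D) (n : ℕ) :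
    ‖iteratedFDeriv ℝ n (fun y => (f y).comp (g y)) x‖ ≤ ∑ i ∈ Finset.range (n + 1),
      (n.choose i : ℝ) * ‖iteratedFDeriv ℝ i f x‖ * ‖iteratedFDeriv ℝ (n - i) g x‖ :=
  (ContinuousLinearMap.compL ℝ E F G).norm_iteratedFDeriv_le_of_bilinear_of_le_one hf hg x
    (infty_ge n) (ContinuousLinearMap.norm_compL_le ℝ E F G)

/-- The `C^k` size of the tangential part of a form is controlled by the form. -/
theorem exists_bound_radialExt_tangential (k : ℕ) :
    ∃ C : ℝ, 0 < C ∧ ∀ G : OneForm, ContDiff ℝ ∞ G → ∀ δ : ℝ,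
      (∀ j ≤ k, ∀ x ∈ closedBall4, ‖iteratedFDeriv ℝ j G x‖ ≤ δ) → ∀ m ≤ k, ∀ x : S3,
        ‖iteratedFDeriv ℝ m (radialExt fun y : S3 => (G y).comp (tangentProj y)) (x : R4)‖ ≤
          C * δ := by
  obtain ⟨D, hD1, hD⟩ := exists_bound_iteratedFDeriv contDiff_unitExt k
  obtain ⟨T, hT1, hT⟩ := exists_bound_iteratedFDeriv contDiff_tangentProj k
  -- The factor 2^k T comes from the Leibniz rule for composition with `tangentProj`, and k! D^k
  -- from the chain rule for composition with `unitExt`.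
  have hC0 : 0 < (k.factorial : ℝ) * 2 ^ k * T * D ^ k := by positivity
  refine ⟨(k.factorial : ℝ) * 2 ^ k * T * D ^ k, hC0,
    fun G hG δ hδ m hm x => ?_⟩
  have hx : ‖(x : R4)‖ = 1 := by simp
  have hxb : (x : R4) ∈ closedBall4 := mem_closedBall4.2 hx.le
  have hδ0 : 0 ≤ δ := (norm_nonneg _).trans (hδ 0 (Nat.zero_le _) x hxb)
  have hH : ∀ i ≤ m, ‖iteratedFDeriv ℝ i (fun z => (G z).comp (tangentProj z)) (x : R4)‖ ≤
      2 ^ k * T * δ := by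
    intro i hi
    refine (norm_iteratedFDeriv_clm_comp_le hG contDiff_tangentProj (x : R4) i).trans ?_
    have h2 : ∑ j ∈ Finset.range (i + 1), (i.choose j : ℝ) * ‖iteratedFDeriv ℝ j G x‖ *
        ‖iteratedFDeriv ℝ (i - j) tangentProj x‖ ≤
        ∑ j ∈ Finset.range (i + 1), (i.choose j : ℝ) * (δ * T) := by
      refine Finset.sum_le_sum fun j hj => ?_
      rw [Finset.mem_range] at hj
      rw [mul_assoc]
      have e1 := hδ j (by omega) x hxb
      have e2 := hT (i - j) (by omega) x hxb
      gcongr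
    have h3 : ∑ j ∈ Finset.range (i + 1), (i.choose j : ℝ) * (δ * T) = 2 ^ i * (δ * T) := by
      rw [← Finset.sum_mul]
      congr 1
      exact_mod_cast Nat.sum_range_choose i
    rw [h3] at h2
    calc _ ≤ 2 ^ i * (δ * T) := h2
      _ ≤ 2 ^ k * (δ * T) := by
        gcongr
        · norm_num
        · exact hi.trans hm
      _ = _ := by ring
  rw [(radialExt_eventuallyEq (fun z => (G z).comp (tangentProj z)) hx).iteratedFDeriv ℝ m
    |>.self_of_nhds]
  have h4 := norm_iteratedFDeriv_comp_le (contDiff_comp_tangentProj hG) contDiff_unitExt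
    (infty_ge m) (x : R4) (C := 2 ^ k * T * δ) (D := D)
    (fun i hi => by
      rw [unitExt_sphere hx]
      exact hH i hi)
    (fun i hi1 hi => (hD i (by omega) x hxb).trans (le_self_pow₀ hD1 (by omega)))
  refine h4.trans ?_
  calc (m.factorial : ℝ) * (2 ^ k * T * δ) * D ^ m
      ≤ (k.factorial : ℝ) * (2 ^ k * T * δ) * D ^ k := by
        gcongr
    _ = _ := by ring

/-- Polynomial boundary connections are dense, and remain close under small polynomial
perturbations. -/
theorem exists_polynomial_ckClose (A₀ : BoundaryConnection) (k : ℕ) {ε : ℝ} (hε : 0 < ε) :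
    ∃ P : Fin 3 → Fin 4 → Poly4, ∀ B : Fin 3 → Fin 4 → Poly4, ∃ t₀ : ℝ, 0 < t₀ ∧
      ∀ t : ℝ, |t| < t₀ → (tangential (polyForm fun l b => P l b + t • B l b)
        (contDiff_polyForm _)).CkClose k ε A₀ := by
  obtain ⟨F, hF, hF0, hFA⟩ := A₀.exists_extension
  obtain ⟨C, hC, hCG⟩ := exists_bound_radialExt_tangential k
  obtain ⟨P, hP⟩ := exists_polyForm_approx (R := 3) (by norm_num) hF hF0 k
    (ε := ε / (4 * C)) (by positivity)
  refine ⟨P, fun B => ?_⟩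
  obtain ⟨K, hK1, hK⟩ := exists_bound_iteratedFDeriv (contDiff_polyForm B) k
  -- The approximation error and the added term t·B contribute at most ε/(4C) each, so the
  -- tangential parts differ by at most ε/2.
  refine ⟨ε / (4 * C * K), by positivity, fun t ht m hm x => ?_⟩
  have hsum : ∀ x, polyForm (fun l b => P l b + t • B l b) x - F x =
      (polyForm P x - F x) + t • polyForm B x := by
    intro x
    refine form_ext fun l b => ?_
    simp [polyForm_apply]
    ring
  set G : OneForm := fun x => (polyForm P x - F x) + t • polyForm B x with hG
  have hGc : ContDiff ℝ ∞ G :=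
    ((contDiff_polyForm P).sub hF).add ((contDiff_polyForm B).const_smul t)
  have hbound : ∀ j ≤ k, ∀ x ∈ closedBall4, ‖iteratedFDeriv ℝ j G x‖ ≤ ε / (2 * C) := by
    intro j hj x hx
    have e1 : iteratedFDeriv ℝ j G x = iteratedFDeriv ℝ j (fun x => polyForm P x - F x) x +
        t • iteratedFDeriv ℝ j (polyForm B) x := by
      have c1 : ContDiffAt ℝ j (fun x => polyForm P x - F x) x :=
        (((contDiff_polyForm P).sub hF).of_le (infty_ge j)).contDiffAt
      have c2 : ContDiffAt ℝ j (polyForm B) x :=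
        ((contDiff_polyForm B).of_le (infty_ge j)).contDiffAt
      have c3 : ContDiffAt ℝ j (fun x => t • polyForm B x) x := c2.const_smul t
      have e2 := iteratedFDeriv_add_apply c1 c3
      have e3 := iteratedFDeriv_const_smul_apply' (a := t) c2
      rw [← e3]
      exact e2
    rw [e1]
    refine (norm_add_le _ _).trans ?_
    rw [norm_smul, Real.norm_eq_abs]
    have e4 := (hP j hj x hx).le
    have e5 : |t| * ‖iteratedFDeriv ℝ j (polyForm B) x‖ ≤ ε / (4 * C * K) * K := by
      have := hK j hj x hx
      gcongr
    have e6 : ε / (4 * C * K) * K = ε / (4 * C) := by field_simp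
    have e7 : ε / (2 * C) = ε / (4 * C) + ε / (4 * C) := by field_simp; norm_num
    rw [e7]
    linarith
  have hform : (fun y : S3 => (tangential (polyForm fun l b => P l b + t • B l b)
      (contDiff_polyForm _)).form y - A₀.form y) = fun y : S3 => (G y).comp (tangentProj y) := by
    funext y
    -- Projecting changes nothing here, since a boundary connection kills the normal direction.
    have h1 : A₀.form y = (F y).comp (tangentProj y) := by
      ext1 v
      rw [hFA, ContinuousLinearMap.comp_apply, tangentProj_apply, map_sub, map_smul,
        A₀.normal_eq_zero, smul_zero, sub_zero]
    rw [hG]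
    dsimp only
    rw [← hsum, h1, ContinuousLinearMap.sub_comp]
    rfl
  rw [hform]
  refine (hCG G hGc _ hbound m hm x).trans_lt ?_
  rw [mul_div_assoc', div_lt_iff₀ (by positivity)]
  nlinarith

/-! ### Anti-self-dual algebra and the integral of dh_p -/

/-- The Levi-Civita symbol as an integer. -/
def leviInt (a b c d : Fin 4) : ℤ :=
  (Matrix.of fun r s : Fin 4 => if ![a, b, c, d] r = s then (1 : ℤ) else 0).det

theorem leviCivita_eq (a b c d : Fin 4) : leviCivita a b c d = leviInt a b c d := by
  rw [leviInt, Int.cast_det, leviCivita]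
  congr 1
  ext r s
  simp

/-- The standard basis of the constant anti-self-dual 2-forms. -/
def asdInt : Fin 3 → Matrix (Fin 4) (Fin 4) ℤ := ![
  !![0, 1, 0, 0; -1, 0, 0, 0; 0, 0, 0, -1; 0, 0, 1, 0],
  !![0, 0, 1, 0; 0, 0, 0, 1; -1, 0, 0, 0; 0, -1, 0, 0],
  !![0, 0, 0, 1; 0, 0, -1, 0; 0, 1, 0, 0; -1, 0, 0, 0]]

theorem sum_asdInt_mul : ∀ i j, ∑ a, ∑ b, asdInt i a b * asdInt j a b = if i = j then 4 else 0 := by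
  decide

-- Integer entries turn *ω_l = -ω_l into a finite decidable check; the factor -2 is -1 divided by
-- the ½ in `hodgeStar`.
set_option maxRecDepth 100000 in
theorem sum_leviInt_mul_asdInt :
    ∀ l a b, ∑ c, ∑ d, leviInt a b c d * asdInt l c d = -2 * asdInt l a b := by
  decide +kernel

/-- These are the coefficients of d(Im x̄ dx) = Im(dx̄ ∧ dx), which is where anti-self-duality
enters. -/
theorem quatForm_sub (c b : Fin 4) (l : Fin 3) :
    quatForm c (stdVec b) l - quatForm b (stdVec c) l = 2 * (asdInt l c b : ℝ) := by
  fin_cases l <;> fin_cases c <;> fin_cases b <;>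
    simp [quatForm_apply, imPart_star_mul, asdInt] <;> norm_num

theorem asd_add (w z : Fin 4 → Fin 4 → ℝ) : asd (w + z) = asd w + asd z := by
  ext a b
  simp only [asd, hodgeStar, Pi.add_apply, mul_add, Finset.sum_add_distrib]
  ring

theorem asd_smul (r : ℝ) (w : Fin 4 → Fin 4 → ℝ) : asd (r • w) = r • asd w := by
  ext a b
  simp only [asd, hodgeStar, Pi.smul_apply, smul_eq_mul, mul_left_comm _ r, ← Finset.mul_sum]
  ring

theorem asd_asdInt (l : Fin 3) :
    asd (fun a b => (asdInt l a b : ℝ)) = fun a b => (asdInt l a b : ℝ) := by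
  ext a b
  have h : ∑ c, ∑ d, leviCivita a b c d * (asdInt l c d : ℝ) = -2 * (asdInt l a b : ℝ) := by
    simp only [leviCivita_eq]
    exact_mod_cast sum_leviInt_mul_asdInt l a b
  simp only [asd, hodgeStar, h]
  ring

theorem inner2_add_left (w w' z : Fin 4 → Fin 4 → ℝ) :
    inner2 (w + w') z = inner2 w z + inner2 w' z := by
  simp only [inner2, Pi.add_apply, add_mul, Finset.sum_add_distrib, mul_add]

theorem inner2_add_right (w z z' : Fin 4 → Fin 4 → ℝ) :
    inner2 w (z + z') = inner2 w z + inner2 w z' := by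
  simp only [inner2, Pi.add_apply, Finset.sum_add_distrib, mul_add]

theorem inner2_smul_left (r : ℝ) (w z : Fin 4 → Fin 4 → ℝ) :
    inner2 (r • w) z = r * inner2 w z := by
  simp only [inner2, Pi.smul_apply, smul_eq_mul, mul_assoc, ← Finset.mul_sum]
  ring

theorem inner2_smul_right (r : ℝ) (w z : Fin 4 → Fin 4 → ℝ) :
    inner2 w (r • z) = r * inner2 w z := by
  simp only [inner2, Pi.smul_apply, smul_eq_mul, mul_left_comm _ r, ← Finset.mul_sum]

theorem inner2_asdInt (i j : Fin 3) :
    inner2 (fun a b => (asdInt i a b : ℝ)) (fun a b => (asdInt j a b : ℝ)) =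
      if i = j then 2 else 0 := by
  have h : ∑ a, ∑ b, (asdInt i a b : ℝ) * (asdInt j a b : ℝ) = if i = j then 4 else 0 := by
    exact_mod_cast congrArg (Int.cast : ℤ → ℝ) (sum_asdInt_mul i j)
  rw [inner2, h]
  split_ifs <;> norm_num

/-- Pairing with the anti-self-dual part against a fixed 2-form, as a linear map. -/
def innerAsd (w : Fin 4 → Fin 4 → ℝ) : (Fin 4 → Fin 4 → ℝ) →ₗ[ℝ] ℝ where
  toFun z := inner2 (asd w) (asd z)
  map_add' z z' := by rw [asd_add, inner2_add_right]
  map_smul' r z := by rw [asd_smul, inner2_smul_right]; rfl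

/-- Pairing with a constant form is a continuous linear functional, so it commutes with the
integral. -/
theorem integral_innerAsd (w : Fin 4 → Fin 4 → ℝ) {F : R4 → Fin 4 → Fin 4 → ℝ}
    (hF : ∀ a b, IntegrableOn (fun x => F x a b) ball4) :
    ∫ x in ball4, inner2 (asd w) (asd (F x)) =
      inner2 (asd w) (asd fun a b => ∫ x in ball4, F x a b) := by
  have h1 : ∀ a, Integrable (fun x => F x a) (volume.restrict ball4) := fun a =>
    Integrable.of_eval (hF a)
  have h2 : Integrable F (volume.restrict ball4) := Integrable.of_eval h1
  have h3 := (LinearMap.toContinuousLinearMap (innerAsd w)).integral_comp_comm h2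
  have h4 : (∫ x in ball4, F x) = fun a b => ∫ x in ball4, F x a b := by
    ext a b
    rw [eval_integral h1, eval_integral (hF a)]
  rw [h4] at h3
  exact h3

theorem continuousOn_inner2_asd {F G : R4 → Fin 4 → Fin 4 → ℝ} {s : Set R4}
    (hF : ∀ a b, ContinuousOn (fun x => F x a b) s)
    (hG : ∀ a b, ContinuousOn (fun x => G x a b) s) :
    ContinuousOn (fun x => inner2 (asd (F x)) (asd (G x))) s := by
  unfold inner2 asd hodgeStar
  fun_prop

theorem ContinuousOn.integrableOn_ball4 {f : R4 → ℝ} (hf : ContinuousOn f closedBall4) :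
    IntegrableOn f ball4 :=
  (hf.integrableOn_compact isCompact_closedBall4).mono_set ball4_subset_closedBall4

theorem continuous_extDCoeff_polyForm (Q : Fin 3 → Fin 4 → Poly4) (l : Fin 3) (a b : Fin 4) :
    Continuous fun x => extDCoeff (polyForm Q) l x a b := by
  simp only [extDCoeff_polyForm]
  exact (contDiff_evalFn _).continuous

theorem extDCoeff_harmonicForm {p x : R4} (hp : p ∈ ball4) (hx : x ∈ closedBall4) (i : Fin 3)
    (a b : Fin 4) : extDCoeff (harmonicForm p) i x a b =
      ∑ c, (pd a (kelvin p c) x * quatForm c (stdVec b) i -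
        pd b (kelvin p c) x * quatForm c (stdVec a) i) := by
  have hk := (kelvinDen_pos hp hx).ne'
  have hcomp : ∀ b, component (harmonicForm p) i b =
      fun x => ∑ c, kelvin p c x * quatForm c (stdVec b) i := by
    intro b
    ext y
    simp [component, harmonicForm]
  have hpd : ∀ a b, pd a (component (harmonicForm p) i b) x =
      ∑ c, pd a (kelvin p c) x * quatForm c (stdVec b) i := by
    intro a b
    have hd : ∀ c, DifferentiableAt ℝ (kelvin p c) x := fun c =>
      (contDiffAt_kelvin p c hk).differentiableAt (by simp)
    rw [hcomp, pd_sum fun c _ => (hd c).mul_const _]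
    refine Finset.sum_congr rfl fun c _ => ?_
    rw [pd_mul (hd c) (differentiableAt_const _), pd_const]
    ring
  rw [extDCoeff_eq ((contDiffAt_harmonicForm p hk).differentiableAt (by simp)), hpd, hpd,
    Finset.sum_sub_distrib]

theorem continuousOn_pd_kelvin {p : R4} (hp : p ∈ ball4) (a c : Fin 4) :
    ContinuousOn (pd a (kelvin p c)) closedBall4 := fun x hx =>
  (contDiffAt_pd (m := 0) (contDiffAt_kelvin p c (kelvinDen_pos hp hx).ne')
    (by simp)).continuousAt.continuousWithinAt

theorem continuousOn_extDCoeff_harmonicForm {p : R4} (hp : p ∈ ball4) (i : Fin 3)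
    (a b : Fin 4) : ContinuousOn (fun x => extDCoeff (harmonicForm p) i x a b) closedBall4 := by
  refine ContinuousOn.congr (f := fun x => ∑ c, (pd a (kelvin p c) x * quatForm c (stdVec b) i -
    pd b (kelvin p c) x * quatForm c (stdVec a) i)) ?_
    fun x hx => extDCoeff_harmonicForm hp hx i a b
  have h := continuousOn_pd_kelvin hp
  exact continuousOn_finsetSum _ fun c _ =>
    ((h a c).mul continuousOn_const).sub ((h b c).mul continuousOn_const)

/-- By `integral_pd_kelvin` the average of dh_p over the ball is that of d(Im x̄ dx), the case p =
0. -/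
theorem integral_extDCoeff_harmonicForm {p : R4} (hp : p ∈ ball4) (i : Fin 3) (a b : Fin 4) :
    ∫ x in ball4, extDCoeff (harmonicForm p) i x a b =
      2 * volume.real ball4 * (asdInt i a b : ℝ) := by
  have h : ∀ a c, IntegrableOn (pd a (kelvin p c)) ball4 := fun a c =>
    ContinuousOn.integrableOn_ball4 (continuousOn_pd_kelvin hp a c)
  have hg : ∀ c ∈ Finset.univ, IntegrableOn (fun x => pd a (kelvin p c) x *
      quatForm c (stdVec b) i - pd b (kelvin p c) x * quatForm c (stdVec a) i) ball4 :=
    fun c _ => ((h a c).mul_const _).sub ((h b c).mul_const _)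
  rw [setIntegral_congr_fun isOpen_ball4.measurableSet fun x hx =>
      extDCoeff_harmonicForm hp (ball4_subset_closedBall4 hx) i a b,
    integral_finsetSum _ hg]
  have h1 : ∀ c, ∫ x in ball4, (pd a (kelvin p c) x * quatForm c (stdVec b) i -
      pd b (kelvin p c) x * quatForm c (stdVec a) i) =
        (if c = a then volume.real ball4 else 0) * quatForm c (stdVec b) i -
          (if c = b then volume.real ball4 else 0) * quatForm c (stdVec a) i := by
    intro c
    rw [integral_sub ((h a c).mul_const _) ((h b c).mul_const _), integral_mul_const,
      integral_mul_const, integral_pd_kelvin hp, integral_pd_kelvin hp]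
  simp only [h1, Finset.sum_sub_distrib, ite_mul, zero_mul, Finset.sum_ite_eq', Finset.mem_univ,
    if_true, ← mul_sub, quatForm_sub]
  ring

/-! ### The perturbing form and its effect on the matrix -/

/-- The coefficients of the form `∑ c_l (Im (x̄ dx))_l`, with `c = (1, 2, 3)`. -/
def diagPoly (l : Fin 3) (b : Fin 4) : Poly4 :=
  ∑ a, MvPolynomial.C (((l : ℕ) + 1 : ℝ) * quatForm a (stdVec b) l) * MvPolynomial.X a

theorem pderiv_diagPoly (l : Fin 3) (a b : Fin 4) :
    MvPolynomial.pderiv a (diagPoly l b) =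
      MvPolynomial.C (((l : ℕ) + 1 : ℝ) * quatForm a (stdVec b) l) := by
  rw [diagPoly, map_sum, Finset.sum_eq_single a]
  · simp
  · intro c _ hc
    rw [MvPolynomial.pderiv_C_mul, MvPolynomial.pderiv_X_of_ne hc]
    simp
  · simp

theorem isCoclosedPoly_add_smul {Q B : Fin 3 → Fin 4 → Poly4} (hQ : IsCoclosedPoly Q)
    (hB : IsCoclosedPoly B) (t : ℝ) : IsCoclosedPoly fun l b => Q l b + t • B l b := by
  intro l b
  have h : ∀ a, MvPolynomial.pderiv a (MvPolynomial.pderiv a (Q l b + t • B l b) -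
      MvPolynomial.pderiv b (Q l a + t • B l a)) =
      MvPolynomial.pderiv a (MvPolynomial.pderiv a (Q l b) - MvPolynomial.pderiv b (Q l a)) +
      t • MvPolynomial.pderiv a
        (MvPolynomial.pderiv a (B l b) - MvPolynomial.pderiv b (B l a)) := by
    intro a
    simp only [map_add, map_sub, Derivation.map_smul, smul_sub]
    ring
  simp only [h, Finset.sum_add_distrib, ← Finset.smul_sum, hQ l b, hB l b, smul_zero, add_zero]

/-- The coefficients are linear, so the differential is constant and the perturbation solves its own
Dirichlet problem. -/
theorem isCoclosedPoly_diagPoly : IsCoclosedPoly diagPoly := by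
  intro l b
  simp [pderiv_diagPoly]

theorem polyForm_add_smul (Q B : Fin 3 → Fin 4 → Poly4) (t : ℝ) (x : R4) :
    polyForm (fun l b => Q l b + t • B l b) x = polyForm Q x + t • polyForm B x := by
  refine form_ext fun l b => ?_
  simp [polyForm_apply]

theorem extDCoeff_polyForm_add_smul (Q B : Fin 3 → Fin 4 → Poly4) (t : ℝ) (l : Fin 3) (x : R4) :
    extDCoeff (polyForm fun l b => Q l b + t • B l b) l x =
      extDCoeff (polyForm Q) l x + t • extDCoeff (polyForm B) l x := by
  ext a b
  simp only [Pi.add_apply, Pi.smul_apply, extDCoeff_polyForm, map_add, Derivation.map_smul,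
    evalFn_sub, evalFn_add, evalFn_smul, smul_eq_mul]
  ring

theorem extDCoeff_diagPoly (l : Fin 3) (x : R4) :
    extDCoeff (polyForm diagPoly) l x =
      (2 * ((l : ℕ) + 1 : ℝ)) • fun a b => (asdInt l a b : ℝ) := by
  ext a b
  simp only [extDCoeff_polyForm, pderiv_diagPoly, evalFn_sub, evalFn_C, Pi.smul_apply,
    smul_eq_mul, ← mul_sub, quatForm_sub]
  ring

/-- Off-diagonal entries vanish by orthogonality of the ω_l. On the diagonal, 8 is the product of 2
from dB, 2 from the integral of dh_p, and |ω_i|² = 2. -/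
theorem pairing_diagPoly {p : R4} (hp : p ∈ ball4) (i j : Fin 3) :
    pairing (polyForm diagPoly) (harmonicForm p) i j =
      if j = i then 8 * volume.real ball4 * ((i : ℕ) + 1 : ℝ) else 0 := by
  have h1 : (fun a b => ∫ x in ball4, extDCoeff (harmonicForm p) i x a b) =
      (2 * volume.real ball4) • fun a b => (asdInt i a b : ℝ) := by
    ext a b
    rw [integral_extDCoeff_harmonicForm hp]
    rfl
  simp only [pairing, extDCoeff_diagPoly]
  rw [integral_innerAsd _ fun a b =>
    ContinuousOn.integrableOn_ball4 (continuousOn_extDCoeff_harmonicForm hp i a b), h1,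
    asd_smul, asd_smul, asd_asdInt, asd_asdInt, inner2_smul_left, inner2_smul_right,
    inner2_asdInt]
  split_ifs with h
  · subst h
    ring
  · ring

theorem pairing_add_smul {p : R4} (hp : p ∈ ball4) (Q B : Fin 3 → Fin 4 → Poly4) (t : ℝ)
    (i j : Fin 3) :
    pairing (polyForm fun l b => Q l b + t • B l b) (harmonicForm p) i j =
      pairing (polyForm Q) (harmonicForm p) i j +
        t * pairing (polyForm B) (harmonicForm p) i j := by
  have h : ∀ Q : Fin 3 → Fin 4 → Poly4, IntegrableOn (fun x => inner2
      (asd (extDCoeff (polyForm Q) j x)) (asd (extDCoeff (harmonicForm p) i x))) ball4 :=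
    fun Q => ContinuousOn.integrableOn_ball4 (continuousOn_inner2_asd
      (fun a b => (continuous_extDCoeff_polyForm Q j a b).continuousOn)
      (continuousOn_extDCoeff_harmonicForm hp i))
  simp only [pairing, extDCoeff_polyForm_add_smul, asd_add, asd_smul, inner2_add_left,
    inner2_smul_left]
  rw [integral_add (h Q) ((h B).const_mul t), integral_const_mul]

/-- The matrix computed from one solution is independent of the choice of the solutions. -/
theorem IsLinearSolution.isMatrixM {A₀ : BoundaryConnection} {A : OneForm}
    (hA : IsLinearSolution A₀ A) {p : R4} (hp : p ∈ ball4) :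
    IsMatrixM A₀ p (Matrix.of (pairing A (harmonicForm p))) := by
  refine ⟨⟨A, hA⟩, ⟨_, isHarmonicForm_harmonicForm hp⟩, fun A' h hA' hh => ?_⟩
  ext i j
  refine integral_congr_ae ?_
  filter_upwards [IsLinearSolution.ae_extDCoeff_eq hA hA' j,
    ae_restrict_mem isOpen_ball4.measurableSet] with x hx hxb
  rw [hx, IsHarmonicForm.extDCoeff_eq hp hh hxb]

/-! ### Generic simplicity of singular values -/

open Polynomial in
/-- The discriminant of a monic cubic polynomial in terms of its coefficients. -/
def cubicDiscr {R : Type*} [CommRing R] (p : R[X]) : R :=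
  p.coeff 2 ^ 2 * p.coeff 1 ^ 2 - 4 * p.coeff 1 ^ 3 - 4 * p.coeff 2 ^ 3 * p.coeff 0 -
    27 * p.coeff 0 ^ 2 + 18 * p.coeff 2 * p.coeff 1 * p.coeff 0

-- Compatibility with ring homomorphisms allows the discriminant to be computed once for a matrix
-- over ℝ[X] and then evaluated at each s.
open Polynomial in
theorem cubicDiscr_map {R S : Type*} [CommRing R] [CommRing S] (f : R →+* S) (p : R[X]) :
    cubicDiscr (p.map f) = f (cubicDiscr p) := by
  simp [cubicDiscr, map_ofNat]

open Polynomial in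
theorem cubicDiscr_prod {R : Type*} [CommRing R] [Nontrivial R] (a b c : R) :
    cubicDiscr ((X - C a) * (X - C b) * (X - C c)) = ((a - b) * (a - c) * (b - c)) ^ 2 := by
  have h : (X - C a) * (X - C b) * (X - C c) =
      (Cubic.mk 1 (-(a + b + c)) (a * b + a * c + b * c) (-(a * b * c))).toPoly := by
    simp only [Cubic.toPoly, map_neg, map_add, map_mul, map_one]
    ring
  rw [h]
  simp only [cubicDiscr, Cubic.coeff_eq_b, Cubic.coeff_eq_c, Cubic.coeff_eq_d]
  ring

-- Evaluation at y gives det(y - rT) = r³ det(y/r - T).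
open Polynomial in
theorem charpoly_smul_eq {T : Matrix (Fin 3) (Fin 3) ℝ} {a b c r : ℝ} (hr : r ≠ 0)
    (h : T.charpoly = (X - C a) * (X - C b) * (X - C c)) :
    (r • T).charpoly = (X - C (r * a)) * (X - C (r * b)) * (X - C (r * c)) := by
  refine Polynomial.funext fun y => ?_
  have h1 : (Matrix.scalar (Fin 3) y - r • T) = r • (Matrix.scalar (Fin 3) (y / r) - T) := by
    ext i j
    by_cases hij : i = j
    · subst hij
      simp
      field_simp
    · simp [hij]
  rw [Matrix.eval_charpoly, h1, Matrix.det_smul, ← Matrix.eval_charpoly, h]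
  simp
  field_simp

open Polynomial in
/-- A real matrix `S` has simple, nonzero singular values when `det S` and the discriminant of
`SᵀS` do not vanish. -/
theorem exists_charpoly_eq_of_discr_ne_zero {S : Matrix (Fin 3) (Fin 3) ℝ} (hS : S.det ≠ 0)
    (hD : cubicDiscr (S.transpose * S).charpoly ≠ 0) :
    ∃ μ₁ μ₂ μ₃ : ℝ, μ₁ > μ₂ ∧ μ₂ > μ₃ ∧ μ₃ > 0 ∧
      (S.transpose * S).charpoly = (X - C μ₁) * (X - C μ₂) * (X - C μ₃) := by
  have hpd : (S.transpose * S).PosDef := by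
    rw [← Matrix.conjTranspose_eq_transpose_of_trivial]
    exact Matrix.PosDef.conjTranspose_mul_self S
      (Matrix.mulVec_injective_of_isUnit ((Matrix.isUnit_iff_isUnit_det S).2 hS.isUnit))
  have hpos := hpd.eigenvalues_pos
  have hc := hpd.1.charpoly_eq
  rw [Fin.prod_univ_three] at hc
  generalize hpd.1.eigenvalues = e at hpos hc
  simp only [RCLike.ofReal_real_eq_id, id] at hc
  rw [hc, cubicDiscr_prod] at hD
  have hab : e 0 ≠ e 1 := fun h => hD (by rw [h]; ring)
  have hac : e 0 ≠ e 2 := fun h => hD (by rw [h]; ring)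
  have hbc : e 1 ≠ e 2 := fun h => hD (by rw [h]; ring)
  rw [hc]
  -- Sorting the three eigenvalues: of the eight sign patterns two are cyclic and contradictory, the
  -- others are the six orderings.
  rcases hab.lt_or_gt with h1 | h1 <;> rcases hac.lt_or_gt with h2 | h2 <;>
    rcases hbc.lt_or_gt with h3 | h3
  · exact ⟨_, _, _, h3, h1, hpos 0, by ring⟩
  · exact ⟨_, _, _, h3, h2, hpos 0, by ring⟩
  · exact absurd (h1.trans h3) h2.not_gt
  · exact ⟨_, _, _, h1, h2, hpos 2, by ring⟩
  · exact ⟨_, _, _, h2, h1, hpos 1, by ring⟩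
  · exact absurd (h1.trans h2) (by simpa using h3.le)
  · exact ⟨_, _, _, h2, h3, hpos 1, by ring⟩
  · exact ⟨_, _, _, h1, h3, hpos 2, by ring⟩

open Polynomial in
/-- Arbitrarily small multiples of `diag(κ, 2κ, 3κ)` perturb a matrix to one with simple, nonzero
singular values. -/
theorem exists_small_perturbation (M : Matrix (Fin 3) (Fin 3) ℝ) {κ : ℝ} (hκ : κ ≠ 0) {t₀ : ℝ}
    (ht₀ : 0 < t₀) :
    ∃ t : ℝ, |t| < t₀ ∧ ∃ μ₁ μ₂ μ₃ : ℝ, μ₁ > μ₂ ∧ μ₂ > μ₃ ∧ μ₃ > 0 ∧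
      ((M + t • Matrix.diagonal ![κ, 2 * κ, 3 * κ]).transpose *
        (M + t • Matrix.diagonal ![κ, 2 * κ, 3 * κ])).charpoly =
          (X - C μ₁) * (X - C μ₂) * (X - C μ₃) := by
  set N : Matrix (Fin 3) (Fin 3) ℝ := Matrix.diagonal ![κ, 2 * κ, 3 * κ] with hN
  -- With s = 1/t, M + tN = t(sM + N). In this form M drops out at s = 0, and nonvanishing can be
  -- read off from N alone.
  set S : Matrix (Fin 3) (Fin 3) ℝ[X] := (X : ℝ[X]) • M.map C + N.map C with hS
  have hmap : ∀ s : ℝ, S.map (evalRingHom s) = s • M + N := by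
    intro s
    ext i j
    simp [hS]
    exact mul_comm _ _
  set f : ℝ[X] := S.det * cubicDiscr (S.transpose * S).charpoly with hf
  have hfe : ∀ s, f.eval s = (s • M + N).det *
      cubicDiscr ((s • M + N).transpose * (s • M + N)).charpoly := by
    intro s
    rw [← hmap, ← Matrix.transpose_map, ← Matrix.map_mul, Matrix.charpoly_map, cubicDiscr_map,
      ← RingHom.mapMatrix_apply, ← RingHom.map_det, hf, eval_mul]
    rfl
  have hf0 : f ≠ 0 := by
    intro h
    have h0 := hfe 0
    rw [h, eval_zero, zero_smul, zero_add, hN, Matrix.diagonal_transpose,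
      Matrix.diagonal_mul_diagonal, Matrix.charpoly_diagonal, Matrix.det_diagonal,
      Fin.prod_univ_three, Fin.prod_univ_three, cubicDiscr_prod] at h0
    simp only [Matrix.cons_val] at h0
    -- det N = 6κ³, and the eigenvalues κ², 4κ², 9κ² of NᵀN have discriminant (120κ⁶)² = 14400κ¹².
    have : κ * (2 * κ) * (3 * κ) * ((κ * κ - 2 * κ * (2 * κ)) * (κ * κ - 3 * κ * (3 * κ)) *
        (2 * κ * (2 * κ) - 3 * κ * (3 * κ))) ^ 2 = 86400 * κ ^ 15 := by ring
    rw [this] at h0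
    exact (mul_ne_zero (by norm_num) (pow_ne_zero _ hκ)) h0.symm
  obtain ⟨s, hs1, hs2⟩ := ((Set.Ioi_infinite (1 / t₀)).sdiff
    (f.rootSet_finite ℝ)).nonempty
  have hs0 : 0 < s := (one_div_pos.2 ht₀).trans hs1
  have hfs : f.eval s ≠ 0 := fun h => hs2 ((mem_rootSet_of_ne hf0).2 (by simpa using h))
  rw [hfe] at hfs
  obtain ⟨a, b, c, hab, hbc, hc, h⟩ := exists_charpoly_eq_of_discr_ne_zero
    (left_ne_zero_of_mul hfs) (right_ne_zero_of_mul hfs)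
  have hr : 0 < s⁻¹ * s⁻¹ := by positivity
  refine ⟨s⁻¹, ?_, s⁻¹ * s⁻¹ * a, s⁻¹ * s⁻¹ * b, s⁻¹ * s⁻¹ * c, mul_lt_mul_of_pos_left hab hr,
    mul_lt_mul_of_pos_left hbc hr, mul_pos hr hc, ?_⟩
  · rw [abs_of_pos (inv_pos.2 hs0)]
    exact (inv_lt_comm₀ hs0 ht₀).2 (by simpa using hs1)
  · have h1 : M + s⁻¹ • N = s⁻¹ • (s • M + N) := by
      rw [smul_add, smul_smul, inv_mul_cancel₀ hs0.ne', one_smul]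
    rw [h1, Matrix.transpose_smul, Matrix.smul_mul, Matrix.mul_smul, smul_smul]
    exact charpoly_smul_eq hr.ne' h

/-! ### Conclusion -/

theorem of_pairing_add_smul_diagPoly {p : R4} (hp : p ∈ ball4) (Q : Fin 3 → Fin 4 → Poly4)
    (t : ℝ) :
    Matrix.of (pairing (polyForm fun l b => Q l b + t • diagPoly l b) (harmonicForm p)) =
      Matrix.of (pairing (polyForm Q) (harmonicForm p)) +
        t • Matrix.diagonal ![8 * MeasureTheory.volume.real ball4,
          2 * (8 * MeasureTheory.volume.real ball4),
          3 * (8 * MeasureTheory.volume.real ball4)] := by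
  ext i j
  rw [Matrix.of_apply, pairing_add_smul hp, pairing_diagPoly hp, Matrix.add_apply,
    Matrix.smul_apply, Matrix.of_apply, smul_eq_mul]
  congr 2
  fin_cases i <;> fin_cases j <;> simp <;> ring

theorem exists_ckClose_simple_spectrum (A₀ : BoundaryConnection) {p : R4} (hp : p ∈ ball4) (k : ℕ)
    {ε : ℝ} (hε : 0 < ε) :
    ∃ A₁ : BoundaryConnection, A₁.CkClose k ε A₀ ∧
      ∃ M : Matrix (Fin 3) (Fin 3) ℝ, IsMatrixM A₁ p M ∧
        ∃ μ₁ μ₂ μ₃ : ℝ, μ₁ > μ₂ ∧ μ₂ > μ₃ ∧ μ₃ > 0 ∧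
          (M.transpose * M).charpoly =
            (Polynomial.X - Polynomial.C μ₁) * (Polynomial.X - Polynomial.C μ₂) *
              (Polynomial.X - Polynomial.C μ₃) := by
  obtain ⟨P, hP⟩ := exists_polynomial_ckClose A₀ k hε
  obtain ⟨t₀, ht₀, hclose⟩ := hP diagPoly
  obtain ⟨Q, hQ, hPQ⟩ := exists_isCoclosedPoly P
  obtain ⟨t, ht, hμ⟩ := exists_small_perturbation
    (Matrix.of (pairing (polyForm Q) (harmonicForm p)))
    (κ := 8 * MeasureTheory.volume.real ball4) (by have := volume_ball4_pos; positivity) ht₀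
  -- The boundary connection is the tangential part of P + tB, while the solution is Q + tB; P and Q
  -- agree on tangent vectors of the sphere.
  refine ⟨_, hclose t ht, _, IsLinearSolution.isMatrixM (isLinearSolution_polyForm
    (isCoclosedPoly_add_smul hQ isCoclosedPoly_diagPoly t) fun x v hv => ?_) hp, ?_⟩
  · rw [tangential_form_apply _ x hv, polyForm_add_smul, polyForm_add_smul, add_apply, add_apply,
      hPQ x v hv]
  · rw [of_pairing_add_smul_diagPoly hp]
    exact hμ

end YangMillsBall

end

theorem proposition8p2 (A₀ : YangMillsBall.BoundaryConnection) (p₀ : YangMillsBall.R4)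
    (hp₀ : p₀ ∈ YangMillsBall.ball4) (k : ℕ) (ε : ℝ) (hε : 0 < ε) :
    ∃ A₁ : YangMillsBall.BoundaryConnection, A₁.CkClose k ε A₀ ∧
      ∃ M : Matrix (Fin 3) (Fin 3) ℝ, YangMillsBall.IsMatrixM A₁ p₀ M ∧
        ∃ μ₁ μ₂ μ₃ : ℝ, μ₁ > μ₂ ∧ μ₂ > μ₃ ∧ μ₃ > 0 ∧
          (M.transpose * M).charpoly =
            (Polynomial.X - Polynomial.C μ₁) * (Polynomial.X - Polynomial.C μ₂) *
              (Polynomial.X - Polynomial.C μ₃) :=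
  YangMillsBall.exists_ckClose_simple_spectrum A₀ hp₀ k hε
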